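/- **Theorem (Duality Theorem for (I)LGL).** *Algebras.* An *ILGL algebra* is a Heyting algebra $\mathbb A$ with binary operations $*, -\!\!*, *\!\!-$ such that for all $a,b,c$: $a*b\le c$ iff $a\le b -\!\!* c$ iff $b\le a *\!\!- c$. An *LGL algebra* is an ILGL algebra whose underlying Heyting algebra is Boolean. Morphisms of both categories $\mathrm{ILGLAlg}$, $\mathrm{LGLAlg}$ are the homomorphisms preserving all operations. *Spaces.* Let $X$ be a set with a composition $\circ: X\times X\to\mathcal P(X)$ and a preorder $\preccurlyeq$. For $A,B\subseteq X$ put $A\Rightarrow B=\{x\mid \forall y:\ x\preccurlyeq y,\ y\in A \text{ imply } y\in B\}$, $A\bullet B=\{x\mid \exists w,y,z:\ w\preccurlyeq x,\ w\in y\circ z,\ y\in A,\ z\in B\}$, $A -\!\!\bullet B=\{x\mid \forall w,y,z:\ x\preccurlyeq w,\ z\in w\circ y,\ y\in A \text{ imply } z\in B\}$, $A \bullet\!\!- B=\{x\mid \forall w,y,z:\ x\preccurlyeq w,\ z\in y\circ w,\ y\in A \text{ imply } z\in B\}$. An *Esakia space* is a compact partially ordered topological space in which $x\not\preccurlyeq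 y$ implies that some clopen up-set contains $x$ but not $y$, and in which the down-set generated by a clopen set is clopen. An *ILGL space* is an Esakia space $X$ with a composition $\circ$ such that (i) the clopen up-sets are closed under $\bullet$, $-\!\!\bullet$, $\bullet\!\!-$, and (ii) whenever $x\notin y\circ z$ there are clopen up-sets $C_1\ni y$, $C_2\ni z$ with $x\notin C_1\bullet C_2$. A morphism of ILGL spaces is a continuous map $g:X\to X'$ such that: 1. $x\preccurlyeq y$ implies $g(x)\preccurlyeq' g(y)$; 2. $g(x)\preccurlyeq' y'$ implies $g(y)=y'$ for some $y\succcurlyeq x$; 3. $x\in y\circ z$ implies $g(x)\in g(y)\circ' g(z)$; 4. if $w'\preccurlyeq' g(x)$ and $w'\in y'\circ' z'$, there are $w,y,z$ with $w\preccurlyeq x$, $w\in y\circ z$, $y'\preccurlyeq' g(y)$, $z'\preccurlyeq' g(z)$; 5. if $g(x)\preccurlyeq' w'$ and $z'\in w'\circ' y'$, there are $w,y,z$ with $x\preccurlyeq w$, $z\in w\circ y$, $y'\preccurlyeq' g(y)$, $g(z)\preccurlyeq' z'$; 6. if $g(x)\preccurlyeq' w'$ and $z'\in y'\circ' w'$,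 there are $w,y,z$ with $x\preccurlyeq w$, $z\in y\circ w$, $y'\preccurlyeq' g(y)$, $g(z)\preccurlyeq' z'$. *LGL spaces* and their morphisms are obtained by replacing $\preccurlyeq$ by $=$ throughout: an LGL space is a Stone space (compact, Hausdorff, totally disconnected) with a composition $\circ$ such that clopen sets are closed under the three operations and (ii) holds with clopen sets; a morphism is a continuous map satisfying conditions 3--6 with $\preccurlyeq,\preccurlyeq'$ read as equality. This gives categories $\mathrm{ILGLSp}$ and $\mathrm{LGLSp}$. *Functors.* For an (I)LGL algebra $\mathbb A$, $Pr(\mathbb A)$ is the set of (proper) prime filters of $\mathbb A$, ordered by inclusion (this order is equality in the Boolean case), with the topology generated by the sets $\{F\mid a\in F\}$ and their complements (the complements being redundant in the Boolean case), and with $F\circ_{\mathbb A}F'=\{F''\mid \forall a\in F\,\forall b\in F':\ a*b\in F''\}$. For an ILGL space $X$, $Clop(X)$ is the ILGL algebra of clopen up-sets of $X$ with $\cap,\cup,\Rightarrow,X,\emptyset,\bullet,-\!\!\bullet,\bullet\!\!-$; for an LGL space, it is the LGL algebra of all clopen sets with the Boolean operations and $\bullet,-\!\!\bullet,\bullet\!\!-$.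 Both $Pr$ and $Clop$ are contravariant functors, sending a morphism to its preimage map. *Conclusion.* For ILGL, and likewise for LGL, the maps $$\theta_{\mathbb A}:\mathbb A\to Clop(Pr(\mathbb A)),\quad \theta_{\mathbb A}(a)=\{F\in Pr(\mathbb A)\mid a\in F\},$$ $$\eta_X: X\to Pr(Clop(X)),\quad \eta_X(x)=\{U\in Clop(X)\mid x\in U\},$$ are the components of natural isomorphisms $\theta: Id_{\mathrm{(I)LGLAlg}}\to Clop\circ Pr$ and $\eta: Id_{\mathrm{(I)LGLSp}}\to Pr\circ Clop$ satisfying the triangle identity $Pr(\theta_{\mathbb A})\circ\eta_{Pr(\mathbb A)}=\mathrm{id}_{Pr(\mathbb A)}$. Hence $(Pr,Clop,\theta,\eta)$ is a dual equivalence of categories between $\mathrm{(I)LGLAlg}$ and $\mathrm{(I)LGLSp}$. -/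

import Mathlib

open CategoryTheory Opposite TopologicalSpace

universe u

namespace LayeredLogic

/-! ### Algebras and their homomorphisms -/

/-- A binary operation `star` on an ordered set with its two residuals `wand` and `dnaw`. -/
class LayeredOps (A : Type*) [LE A] where
  star : A → A → A
  wand : A → A → A
  dnaw : A → A → A
  star_le_iff_le_wand : ∀ a b c : A, star a b ≤ c ↔ a ≤ wand b c
  star_le_iff_le_dnaw : ∀ a b c : A, star a b ≤ c ↔ b ≤ dnaw a c

open LayeredOps (star wand dnaw star_le_iff_le_wand star_le_iff_le_dnaw)

/-- Homomorphisms of ILGL algebras: Heyting algebra homomorphisms preserving `*` and both of its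
residuals. -/
@[ext]
structure LayeredHom (A B : Type*) [HeytingAlgebra A] [LayeredOps A] [HeytingAlgebra B]
    [LayeredOps B] extends HeytingHom A B where
  map_star : ∀ a b, toFun (star a b) = star (toFun a) (toFun b)
  map_wand : ∀ a b, toFun (wand a b) = wand (toFun a) (toFun b)
  map_dnaw : ∀ a b, toFun (dnaw a b) = dnaw (toFun a) (toFun b)

/-- The identity homomorphism. -/
def LayeredHom.id (A : Type*) [HeytingAlgebra A] [LayeredOps A] : LayeredHom A A where
  toHeytingHom := HeytingHom.id A
  map_star _ _ := rfl
  map_wand _ _ := rfl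
  map_dnaw _ _ := rfl

/-- FrameComp of homomorphisms, `g` after `f`. -/
def LayeredHom.comp {A B C : Type*} [HeytingAlgebra A] [LayeredOps A] [HeytingAlgebra B]
    [LayeredOps B] [HeytingAlgebra C] [LayeredOps C] (g : LayeredHom B C) (f : LayeredHom A B) :
    LayeredHom A C where
  toHeytingHom := g.toHeytingHom.comp f.toHeytingHom
  map_star a b := (congrArg g.toFun (f.map_star a b)).trans (g.map_star _ _)
  map_wand a b := (congrArg g.toFun (f.map_wand a b)).trans (g.map_wand _ _)
  map_dnaw a b := (congrArg g.toFun (f.map_dnaw a b)).trans (g.map_dnaw _ _)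

/-- ILGL algebras: Heyting algebras with `*` and its two residuals. -/
structure ILGLAlg where
  carrier : Type u
  [heyting : HeytingAlgebra carrier]
  [ops : LayeredOps carrier]

attribute [instance] ILGLAlg.heyting ILGLAlg.ops

instance : Category ILGLAlg.{u} where
  Hom A B := LayeredHom A.carrier B.carrier
  id A := LayeredHom.id A.carrier
  comp f g := g.comp f

/-- LGL algebras: the ILGL algebras whose underlying Heyting algebra is Boolean. -/
structure LGLAlg where
  carrier : Type u
  [boolean : BooleanAlgebra carrier]
  [ops : LayeredOps carrier]

attribute [instance] LGLAlg.boolean LGLAlg.ops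

instance : Category LGLAlg.{u} where
  Hom A B := LayeredHom A.carrier B.carrier
  id A := LayeredHom.id A.carrier
  comp f g := g.comp f

/-! ### Frames and complex operations -/

/-- A nondeterministic, partial composition `X² → 𝒫(X)`. An ILGL frame is a preordered type with
such a composition, an LGL frame is a type with such a composition. -/
class FrameComp (X : Type*) where
  comp : X → X → Set X

open FrameComp (comp)

namespace ILGL

variable {X : Type*} [Preorder X]

/-- The complex operation interpreting `→` on an ILGL frame. -/
def himp (A B : Set X) : Set X :=
  {x | ∀ y, x ≤ y → y ∈ A → y ∈ B}

theorem isUpperSet_himp (A B : Set X) : IsUpperSet (himp A B) :=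
  fun _ _ h hx y hy => hx y (h.trans hy)

variable [FrameComp X]

/-- The complex operation interpreting `*` on an ILGL frame. -/
def bullet (A B : Set X) : Set X :=
  {x | ∃ w y z, w ≤ x ∧ w ∈ comp y z ∧ y ∈ A ∧ z ∈ B}

/-- The complex operation interpreting the first residual on an ILGL frame. -/
def bulletWand (A B : Set X) : Set X :=
  {x | ∀ w y z, x ≤ w → z ∈ comp w y → y ∈ A → z ∈ B}

/-- The complex operation interpreting the second residual on an ILGL frame. -/
def bulletDnaw (A B : Set X) : Set X :=
  {x | ∀ w y z, x ≤ w → z ∈ comp y w → y ∈ A → z ∈ B}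

theorem isUpperSet_bullet (A B : Set X) : IsUpperSet (bullet A B) := by
  rintro x x' h ⟨w, y, z, hw, h'⟩
  exact ⟨w, y, z, hw.trans h, h'⟩

theorem isUpperSet_bulletWand (A B : Set X) : IsUpperSet (bulletWand A B) :=
  fun _ _ h hx w y z hw => hx w y z (h.trans hw)

theorem isUpperSet_bulletDnaw (A B : Set X) : IsUpperSet (bulletDnaw A B) :=
  fun _ _ h hx w y z hw => hx w y z (h.trans hw)

end ILGL

namespace LGL

variable {X : Type*} [FrameComp X]

/-- The complex operation interpreting `*` on an LGL frame. -/
def bullet (A B : Set X) : Set X :=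
  {x | ∃ y ∈ A, ∃ z ∈ B, x ∈ comp y z}

/-- The complex operation interpreting the first residual on an LGL frame. -/
def bulletWand (A B : Set X) : Set X :=
  {x | ∀ y z, z ∈ comp x y → y ∈ A → z ∈ B}

/-- The complex operation interpreting the second residual on an LGL frame. -/
def bulletDnaw (A B : Set X) : Set X :=
  {x | ∀ y z, z ∈ comp y x → y ∈ A → z ∈ B}

end LGL

/-! ### Spaces and their morphisms -/

/-- An Esakia space: a compact partially ordered space with Priestley separation in which the
down-set generated by a clopen set is clopen. -/
class EsakiaSpace (X : Type*) [TopologicalSpace X] [PartialOrder X] : Prop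
    extends CompactSpace X, PriestleySpace X where
  isClopen_lowerClosure : ∀ U : Set X, IsClopen U → IsClopen (lowerClosure U : Set X)

/-- An ILGL space. The closure conditions only ask that the results are clopen, since the three
operations always return upper sets. -/
class ILGLSpace (X : Type*) [TopologicalSpace X] [PartialOrder X] [FrameComp X] : Prop
    extends EsakiaSpace X where
  isClopen_bullet : ∀ U V : Set X, IsClopen U → IsUpperSet U → IsClopen V → IsUpperSet V →
    IsClopen (ILGL.bullet U V)
  isClopen_bulletWand : ∀ U V : Set X, IsClopen U → IsUpperSet U → IsClopen V → IsUpperSet V →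
    IsClopen (ILGL.bulletWand U V)
  isClopen_bulletDnaw : ∀ U V : Set X, IsClopen U → IsUpperSet U → IsClopen V → IsUpperSet V →
    IsClopen (ILGL.bulletDnaw U V)
  exists_separating : ∀ x y z : X, x ∉ comp y z → ∃ U V : Set X,
    IsClopen U ∧ IsUpperSet U ∧ IsClopen V ∧ IsUpperSet V ∧ y ∈ U ∧ z ∈ V ∧ x ∉ ILGL.bullet U V

/-- An LGL space: a Stone space with a composition. -/
class LGLSpace (X : Type*) [TopologicalSpace X] [FrameComp X] : Prop
    extends CompactSpace X, T2Space X, TotallyDisconnectedSpace X where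
  isClopen_bullet : ∀ U V : Set X, IsClopen U → IsClopen V → IsClopen (LGL.bullet U V)
  isClopen_bulletWand : ∀ U V : Set X, IsClopen U → IsClopen V → IsClopen (LGL.bulletWand U V)
  isClopen_bulletDnaw : ∀ U V : Set X, IsClopen U → IsClopen V → IsClopen (LGL.bulletDnaw U V)
  exists_separating : ∀ x y z : X, x ∉ comp y z → ∃ U V : Set X,
    IsClopen U ∧ IsClopen V ∧ y ∈ U ∧ z ∈ V ∧ x ∉ LGL.bullet U V

/-- Morphisms of ILGL spaces: continuous ILGL morphisms. Continuity, monotonicity and the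
p-morphism condition are those of `EsakiaHom`. -/
@[ext]
structure ILGLMap (X Y : Type*) [TopologicalSpace X] [PartialOrder X] [FrameComp X]
    [TopologicalSpace Y] [PartialOrder Y] [FrameComp Y] extends EsakiaHom X Y where
  map_comp : ∀ x y z, x ∈ comp y z → toFun x ∈ comp (toFun y) (toFun z)
  exists_of_bullet : ∀ x w' y' z', w' ≤ toFun x → w' ∈ comp y' z' →
    ∃ w y z, w ≤ x ∧ w ∈ comp y z ∧ y' ≤ toFun y ∧ z' ≤ toFun z
  exists_of_bulletWand : ∀ x w' y' z', toFun x ≤ w' → z' ∈ comp w' y' →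
    ∃ w y z, x ≤ w ∧ z ∈ comp w y ∧ y' ≤ toFun y ∧ toFun z ≤ z'
  exists_of_bulletDnaw : ∀ x w' y' z', toFun x ≤ w' → z' ∈ comp y' w' →
    ∃ w y z, x ≤ w ∧ z ∈ comp y w ∧ y' ≤ toFun y ∧ toFun z ≤ z'

/-- Morphisms of LGL spaces: continuous LGL morphisms. -/
@[ext]
structure LGLMap (X Y : Type*) [TopologicalSpace X] [FrameComp X]
    [TopologicalSpace Y] [FrameComp Y] extends C(X, Y) where
  map_comp : ∀ x y z, x ∈ comp y z → toFun x ∈ comp (toFun y) (toFun z)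
  exists_of_bullet : ∀ x y' z', toFun x ∈ comp y' z' →
    ∃ y z, x ∈ comp y z ∧ toFun y = y' ∧ toFun z = z'
  exists_of_bulletWand : ∀ x y' z', z' ∈ comp (toFun x) y' →
    ∃ y z, z ∈ comp x y ∧ toFun y = y' ∧ toFun z = z'
  exists_of_bulletDnaw : ∀ x y' z', z' ∈ comp y' (toFun x) →
    ∃ y z, z ∈ comp y x ∧ toFun y = y' ∧ toFun z = z'

/-- The identity morphism. -/
def ILGLMap.id (X : Type*) [TopologicalSpace X] [PartialOrder X] [FrameComp X] :
    ILGLMap X X where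
  toEsakiaHom := EsakiaHom.id X
  map_comp _ _ _ h := h
  exists_of_bullet _ w' y' z' h h' := ⟨w', y', z', h, h', le_rfl, le_rfl⟩
  exists_of_bulletWand _ w' y' z' h h' := ⟨w', y', z', h, h', le_rfl, le_rfl⟩
  exists_of_bulletDnaw _ w' y' z' h h' := ⟨w', y', z', h, h', le_rfl, le_rfl⟩

/-- FrameComp of morphisms, `g` after `f`. -/
def ILGLMap.comp {X Y Z : Type*} [TopologicalSpace X] [PartialOrder X] [FrameComp X]
    [TopologicalSpace Y] [PartialOrder Y] [FrameComp Y]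
    [TopologicalSpace Z] [PartialOrder Z] [FrameComp Z]
    (g : ILGLMap Y Z) (f : ILGLMap X Y) : ILGLMap X Z where
  toEsakiaHom := g.toEsakiaHom.comp f.toEsakiaHom
  map_comp x y z h := g.map_comp _ _ _ (f.map_comp x y z h)
  exists_of_bullet x w₂ y₂ z₂ h h' := by
    obtain ⟨w₁, y₁, z₁, h1, h2, h3, h4⟩ := g.exists_of_bullet (f.toFun x) w₂ y₂ z₂ h h'
    obtain ⟨w, y, z, k1, k2, k3, k4⟩ := f.exists_of_bullet x w₁ y₁ z₁ h1 h2
    exact ⟨w, y, z, k1, k2, h3.trans (g.monotone' k3), h4.trans (g.monotone' k4)⟩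
  exists_of_bulletWand x w₂ y₂ z₂ h h' := by
    obtain ⟨w₁, y₁, z₁, h1, h2, h3, h4⟩ := g.exists_of_bulletWand (f.toFun x) w₂ y₂ z₂ h h'
    obtain ⟨w, y, z, k1, k2, k3, k4⟩ := f.exists_of_bulletWand x w₁ y₁ z₁ h1 h2
    exact ⟨w, y, z, k1, k2, h3.trans (g.monotone' k3), (g.monotone' k4).trans h4⟩
  exists_of_bulletDnaw x w₂ y₂ z₂ h h' := by
    obtain ⟨w₁, y₁, z₁, h1, h2, h3, h4⟩ := g.exists_of_bulletDnaw (f.toFun x) w₂ y₂ z₂ h h'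
    obtain ⟨w, y, z, k1, k2, k3, k4⟩ := f.exists_of_bulletDnaw x w₁ y₁ z₁ h1 h2
    exact ⟨w, y, z, k1, k2, h3.trans (g.monotone' k3), (g.monotone' k4).trans h4⟩

/-- The identity morphism. -/
def LGLMap.id (X : Type*) [TopologicalSpace X] [FrameComp X] : LGLMap X X where
  toContinuousMap := ContinuousMap.id X
  map_comp _ _ _ h := h
  exists_of_bullet _ y' z' h := ⟨y', z', h, rfl, rfl⟩
  exists_of_bulletWand _ y' z' h := ⟨y', z', h, rfl, rfl⟩
  exists_of_bulletDnaw _ y' z' h := ⟨y', z', h, rfl, rfl⟩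

/-- FrameComp of morphisms, `g` after `f`. -/
def LGLMap.comp {X Y Z : Type*} [TopologicalSpace X] [FrameComp X]
    [TopologicalSpace Y] [FrameComp Y] [TopologicalSpace Z] [FrameComp Z]
    (g : LGLMap Y Z) (f : LGLMap X Y) : LGLMap X Z where
  toContinuousMap := g.toContinuousMap.comp f.toContinuousMap
  map_comp x y z h := g.map_comp _ _ _ (f.map_comp x y z h)
  exists_of_bullet x y₂ z₂ h := by
    obtain ⟨y₁, z₁, h1, rfl, rfl⟩ := g.exists_of_bullet (f.toFun x) y₂ z₂ h
    obtain ⟨y, z, k1, rfl, rfl⟩ := f.exists_of_bullet x y₁ z₁ h1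
    exact ⟨y, z, k1, rfl, rfl⟩
  exists_of_bulletWand x y₂ z₂ h := by
    obtain ⟨y₁, z₁, h1, rfl, rfl⟩ := g.exists_of_bulletWand (f.toFun x) y₂ z₂ h
    obtain ⟨y, z, k1, rfl, rfl⟩ := f.exists_of_bulletWand x y₁ z₁ h1
    exact ⟨y, z, k1, rfl, rfl⟩
  exists_of_bulletDnaw x y₂ z₂ h := by
    obtain ⟨y₁, z₁, h1, rfl, rfl⟩ := g.exists_of_bulletDnaw (f.toFun x) y₂ z₂ h
    obtain ⟨y, z, k1, rfl, rfl⟩ := f.exists_of_bulletDnaw x y₁ z₁ h1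
    exact ⟨y, z, k1, rfl, rfl⟩

/-- The category of ILGL spaces. -/
structure ILGLSp where
  carrier : Type u
  [top : TopologicalSpace carrier]
  [order : PartialOrder carrier]
  [composition : FrameComp carrier]
  [space : ILGLSpace carrier]

attribute [instance] ILGLSp.top ILGLSp.order ILGLSp.composition ILGLSp.space

instance : Category ILGLSp.{u} where
  Hom X Y := ILGLMap X.carrier Y.carrier
  id X := ILGLMap.id X.carrier
  comp f g := g.comp f

/-- The category of LGL spaces. -/
structure LGLSp where
  carrier : Type u
  [top : TopologicalSpace carrier]
  [composition : FrameComp carrier]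
  [space : LGLSpace carrier]

attribute [instance] LGLSp.top LGLSp.composition LGLSp.space

instance : Category LGLSp.{u} where
  Hom X Y := LGLMap X.carrier Y.carrier
  id X := LGLMap.id X.carrier
  comp f g := g.comp f

/-! ### The algebra of clopen upper sets, and the algebra of clopen sets -/

theorem isClopen_himp {X : Type*} [TopologicalSpace X] [PartialOrder X] [EsakiaSpace X]
    {U V : Set X} (hU : IsClopen U) (hV : IsClopen V) : IsClopen (ILGL.himp U V) := by
  have h : ILGL.himp U V = (lowerClosure (U \ V) : Set X)ᶜ := by
    ext x
    simp only [ILGL.himp, Set.mem_ofPred_eq, Set.mem_compl_iff, SetLike.mem_coe, mem_lowerClosure,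
      Set.mem_sdiff, not_exists, not_and]
    exact ⟨fun h y hy hxy => hy.2 (h y hxy hy.1), fun h y hxy hy => by
      by_contra hv
      exact h y ⟨hy, hv⟩ hxy⟩
  rw [h]
  exact (EsakiaSpace.isClopen_lowerClosure _ (hU.diff hV)).compl

instance (X : Type*) [TopologicalSpace X] [PartialOrder X] [EsakiaSpace X] :
    HeytingAlgebra (ClopenUpperSet X) where
  himp U V := ⟨⟨ILGL.himp U V, isClopen_himp U.isClopen V.isClopen⟩, ILGL.isUpperSet_himp _ _⟩
  compl U := ⟨⟨ILGL.himp U ∅, isClopen_himp U.isClopen isClopen_empty⟩, ILGL.isUpperSet_himp _ _⟩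
  le_himp_iff U V W := by
    constructor
    · intro h x hx
      exact h hx.1 x le_rfl hx.2
    · intro h x hx y hxy hy
      exact h ⟨U.upper hxy hx, hy⟩
  himp_bot U := rfl

instance (X : Type*) [TopologicalSpace X] [PartialOrder X] [FrameComp X] [ILGLSpace X] :
    LayeredOps (ClopenUpperSet X) where
  star U V := ⟨⟨ILGL.bullet U V,
    ILGLSpace.isClopen_bullet _ _ U.isClopen U.upper V.isClopen V.upper⟩,
    ILGL.isUpperSet_bullet _ _⟩
  wand U V := ⟨⟨ILGL.bulletWand U V,
    ILGLSpace.isClopen_bulletWand _ _ U.isClopen U.upper V.isClopen V.upper⟩,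
    ILGL.isUpperSet_bulletWand _ _⟩
  dnaw U V := ⟨⟨ILGL.bulletDnaw U V,
    ILGLSpace.isClopen_bulletDnaw _ _ U.isClopen U.upper V.isClopen V.upper⟩,
    ILGL.isUpperSet_bulletDnaw _ _⟩
  star_le_iff_le_wand U V W := by
    constructor
    · intro h x hx w y z hxw hz hy
      exact h ⟨z, w, y, le_rfl, hz, U.upper hxw hx, hy⟩
    · rintro h x ⟨w, y, z, hwx, hw, hy, hz⟩
      exact W.upper hwx (h hy y z w le_rfl hw hz)
  star_le_iff_le_dnaw U V W := by
    constructor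
    · intro h x hx w y z hxw hz hy
      exact h ⟨z, y, w, le_rfl, hz, hy, V.upper hxw hx⟩
    · rintro h x ⟨w, y, z, hwx, hw, hy, hz⟩
      exact W.upper hwx (h hz z y w le_rfl hw hy)

instance (X : Type*) [TopologicalSpace X] [FrameComp X] [LGLSpace X] :
    LayeredOps (Clopens X) where
  star U V := ⟨LGL.bullet U V, LGLSpace.isClopen_bullet _ _ U.isClopen V.isClopen⟩
  wand U V := ⟨LGL.bulletWand U V, LGLSpace.isClopen_bulletWand _ _ U.isClopen V.isClopen⟩
  dnaw U V := ⟨LGL.bulletDnaw U V, LGLSpace.isClopen_bulletDnaw _ _ U.isClopen V.isClopen⟩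
  star_le_iff_le_wand U V W := by
    constructor
    · intro h x hx y z hz hy
      exact h ⟨x, hx, y, hy, hz⟩
    · rintro h x ⟨y, hy, z, hz, hx⟩
      exact h hy z x hx hz
  star_le_iff_le_dnaw U V W := by
    constructor
    · intro h x hx y z hz hy
      exact h ⟨y, hy, x, hx, hz⟩
    · rintro h x ⟨y, hy, z, hz, hx⟩
      exact h hz y x hx hy

/-- The preimage homomorphism between algebras of clopen upper sets. -/
def ILGLMap.preimage {X Y : Type*} [TopologicalSpace X] [PartialOrder X] [FrameComp X]
    [TopologicalSpace Y] [PartialOrder Y] [FrameComp Y] [ILGLSpace X] [ILGLSpace Y]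
    (g : ILGLMap X Y) : LayeredHom (ClopenUpperSet Y) (ClopenUpperSet X) where
  toFun U := ⟨⟨g.toFun ⁻¹' U, U.isClopen.preimage g.continuous_toFun⟩,
    fun _ _ h hx => U.upper (g.monotone' h) hx⟩
  map_sup' _ _ := rfl
  map_inf' _ _ := rfl
  map_bot' := rfl
  map_himp' U V := by
    ext x
    constructor
    · intro h y hxy hy
      exact h _ (g.monotone' hxy) hy
    · intro h y' hxy hy
      obtain ⟨y, hy1, rfl⟩ := g.exists_map_eq_of_map_le' hxy
      exact h y hy1 hy
  map_star U V := by
    ext x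
    constructor
    · rintro ⟨w', y', z', h, h', hy, hz⟩
      obtain ⟨w, y, z, h1, h2, h3, h4⟩ := g.exists_of_bullet x w' y' z' h h'
      exact ⟨w, y, z, h1, h2, U.upper h3 hy, V.upper h4 hz⟩
    · rintro ⟨w, y, z, h, h', hy, hz⟩
      exact ⟨_, _, _, g.monotone' h, g.map_comp _ _ _ h', hy, hz⟩
  map_wand U V := by
    ext x
    constructor
    · intro h w y z hw hz hy
      exact h _ _ _ (g.monotone' hw) (g.map_comp _ _ _ hz) hy
    · intro h w' y' z' hw hz hy
      obtain ⟨w, y, z, h1, h2, h3, h4⟩ := g.exists_of_bulletWand x w' y' z' hw hz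
      exact V.upper h4 (h w y z h1 h2 (U.upper h3 hy))
  map_dnaw U V := by
    ext x
    constructor
    · intro h w y z hw hz hy
      exact h _ _ _ (g.monotone' hw) (g.map_comp _ _ _ hz) hy
    · intro h w' y' z' hw hz hy
      obtain ⟨w, y, z, h1, h2, h3, h4⟩ := g.exists_of_bulletDnaw x w' y' z' hw hz
      exact V.upper h4 (h w y z h1 h2 (U.upper h3 hy))

/-- The preimage homomorphism between algebras of clopen sets. -/
def LGLMap.preimage {X Y : Type*} [TopologicalSpace X] [FrameComp X]
    [TopologicalSpace Y] [FrameComp Y] [LGLSpace X] [LGLSpace Y]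
    (g : LGLMap X Y) : LayeredHom (Clopens Y) (Clopens X) where
  toFun U := ⟨g.toFun ⁻¹' U, U.isClopen.preimage g.continuous_toFun⟩
  map_sup' _ _ := rfl
  map_inf' _ _ := rfl
  map_bot' := rfl
  map_himp' U V := by
    rfl
  map_star U V := by
    ext x
    constructor
    · rintro ⟨y', hy, z', hz, h⟩
      obtain ⟨y, z, h1, rfl, rfl⟩ := g.exists_of_bullet x y' z' h
      exact ⟨y, hy, z, hz, h1⟩
    · rintro ⟨y, hy, z, hz, h⟩
      exact ⟨_, hy, _, hz, g.map_comp _ _ _ h⟩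
  map_wand U V := by
    ext x
    constructor
    · intro h y z hz hy
      exact h _ _ (g.map_comp _ _ _ hz) hy
    · intro h y' z' hz hy
      obtain ⟨y, z, h1, rfl, rfl⟩ := g.exists_of_bulletWand x y' z' hz
      exact h y z h1 hy
  map_dnaw U V := by
    ext x
    constructor
    · intro h y z hz hy
      exact h _ _ (g.map_comp _ _ _ hz) hy
    · intro h y' z' hz hy
      obtain ⟨y, z, h1, rfl, rfl⟩ := g.exists_of_bulletDnaw x y' z' hz
      exact h y z h1 hy

/-- The contravariant functor of clopen upper sets, with morphisms sent to preimage. -/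
def clopILGL : ILGLSp.{u}ᵒᵖ ⥤ ILGLAlg.{u} where
  obj X := ⟨ClopenUpperSet X.unop.carrier⟩
  map g := g.unop.preimage

/-- The contravariant functor of clopen sets, with morphisms sent to preimage. -/
def clopLGL : LGLSp.{u}ᵒᵖ ⥤ LGLAlg.{u} where
  obj X := ⟨Clopens X.unop.carrier⟩
  map g := g.unop.preimage

/-! ### Prime filters -/

/-- The prime filters of a lattice with bounds; they are proper by definition. -/
def PrimeFilter (A : Type*) [Preorder A] : Type _ := {F : Order.PFilter A // F.IsPrime}

namespace PrimeFilter

instance (A : Type*) [Preorder A] : SetLike (PrimeFilter A) A where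
  coe F := F.1
  coe_injective _ _ h := Subtype.ext (SetLike.coe_injective h)

/-- Prime filters are ordered by inclusion. -/
instance (A : Type*) [Preorder A] : PartialOrder (PrimeFilter A) := .ofSetLike (PrimeFilter A) A

/-- The set of prime filters containing `a`. -/
def theta {A : Type*} [Preorder A] (a : A) : Set (PrimeFilter A) := {F | a ∈ F}

/-- The topology with subbase the sets `theta a` and their complements. -/
instance (A : Type*) [Preorder A] : TopologicalSpace (PrimeFilter A) :=
  .generateFrom (Set.range theta ∪ Set.range fun a => (theta a)ᶜ)

/-- `H ∈ F ∘ G` when `a * b ∈ H` for all `a ∈ F` and `b ∈ G`. -/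
instance (A : Type*) [Preorder A] [LayeredOps A] : FrameComp (PrimeFilter A) where
  comp F G := {H | ∀ a ∈ F, ∀ b ∈ G, star a b ∈ H}

section Basic

variable {A : Type*} [Lattice A] [BoundedOrder A] (F : PrimeFilter A) {a b : A}

theorem mem_of_le (h : a ≤ b) (ha : a ∈ F) : b ∈ F := F.1.mem_of_le h ha

theorem top_mem : ⊤ ∈ F := Order.PFilter.top_mem (F := F.1)

theorem inf_mem_iff : a ⊓ b ∈ F ↔ a ∈ F ∧ b ∈ F := Order.PFilter.inf_mem_iff (F := F.1)

theorem bot_notMem : ⊥ ∉ F := by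
  obtain ⟨c, hc⟩ := F.2.compl_ideal.Nonempty
  exact fun h => hc (F.mem_of_le bot_le h)

theorem sup_mem_iff : a ⊔ b ∈ F ↔ a ∈ F ∨ b ∈ F := by
  constructor
  · intro h
    by_contra! h'
    obtain ⟨c, hc, h1, h2⟩ := F.2.compl_ideal.Directed a h'.1 b h'.2
    exact hc (F.mem_of_le (sup_le h1 h2) h)
  · rintro (h | h)
    · exact F.mem_of_le le_sup_left h
    · exact F.mem_of_le le_sup_right h

/-- A proper prime filter in the elementary sense gives a point of `PrimeFilter A`. -/
def ofSet (S : Set A) (top : ⊤ ∈ S) (bot : ⊥ ∉ S) (up : ∀ a b, a ≤ b → a ∈ S → b ∈ S)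
    (inf : ∀ a b, a ∈ S → b ∈ S → a ⊓ b ∈ S) (sup : ∀ a b, a ⊔ b ∈ S → a ∈ S ∨ b ∈ S) :
    PrimeFilter A :=
  ⟨(Order.IsPFilter.of_def (F := S) ⟨⊤, top⟩
      (fun a ha b hb => ⟨a ⊓ b, inf a b ha hb, inf_le_left, inf_le_right⟩)
      (fun h ha => up _ _ h ha)).toPFilter,
    ⟨⟨fun a b h ha hb => ha (up _ _ h hb), ⟨⊥, bot⟩,
      fun a ha b hb => ⟨a ⊔ b, fun h => (sup a b h).elim ha hb, le_sup_left, le_sup_right⟩⟩⟩⟩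

theorem mem_ofSet (S : Set A) (h1 h2 h3 h4 h5) : a ∈ ofSet S h1 h2 h3 h4 h5 ↔ a ∈ S := Iff.rfl

end Basic

section Separation

variable {A : Type*} [DistribLattice A] [BoundedOrder A]

/-- The prime filter theorem, for a filter and an ideal given as sets. -/
theorem exists_of_disjoint (S I : Set A) (hS : S.Nonempty)
    (upS : ∀ a b, a ≤ b → a ∈ S → b ∈ S) (infS : ∀ a b, a ∈ S → b ∈ S → a ⊓ b ∈ S)
    (hI : I.Nonempty) (downI : ∀ a b, a ≤ b → b ∈ I → a ∈ I)
    (supI : ∀ a b, a ∈ I → b ∈ I → a ⊔ b ∈ I) (h : ∀ a ∈ S, a ∉ I) :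
    ∃ F : PrimeFilter A, (∀ a ∈ S, a ∈ F) ∧ ∀ a ∈ I, a ∉ F := by
  have pS : Order.IsPFilter S := Order.IsPFilter.of_def hS
    (fun a ha b hb => ⟨a ⊓ b, infS a b ha hb, inf_le_left, inf_le_right⟩)
    (fun h ha => upS _ _ h ha)
  have pI : Order.IsIdeal I := ⟨fun a b h ha => downI _ _ h ha, hI,
    fun a ha b hb => ⟨a ⊔ b, supI a b ha hb, le_sup_left, le_sup_right⟩⟩
  have hd : Disjoint (pS.toPFilter : Set A) (pI.toIdeal : Set A) :=
    Set.disjoint_left.2 fun a ha hb => h a ha hb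
  obtain ⟨J, hJ, hIJ, hSJ⟩ := DistribLattice.prime_ideal_of_disjoint_filter_ideal hd
  refine ⟨⟨hJ.toPrimePair.F, hJ.toPrimePair.F_isPrime⟩, fun a ha => ?_, fun a ha => ?_⟩
  · have h1 : a ∉ J := Set.disjoint_left.1 hSJ ha
    have h2 : a ∈ (hJ.toPrimePair.F : Set A) := by
      rw [← hJ.toPrimePair.compl_I_eq_F]
      exact h1
    exact h2
  · intro h'
    have h2 : a ∈ (hJ.toPrimePair.F : Set A) := h'
    rw [← hJ.toPrimePair.compl_I_eq_F] at h2
    exact h2 (hIJ ha)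

theorem exists_mem_notMem {a b : A} (h : ¬a ≤ b) : ∃ F : PrimeFilter A, a ∈ F ∧ b ∉ F := by
  obtain ⟨F, h1, h2⟩ := exists_of_disjoint (Set.Ici a) (Set.Iic b) ⟨a, le_rfl⟩
    (fun _ _ h h' => le_trans (Set.mem_Ici.1 h') h) (fun _ _ h h' => le_inf h h') ⟨b, le_rfl⟩
    (fun _ _ h h' => le_trans h (Set.mem_Iic.1 h')) (fun _ _ h h' => sup_le h h')
    (fun c hc hc' => h (le_trans hc hc'))
  exact ⟨F, h1 a le_rfl, h2 b le_rfl⟩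

variable {m w d : A → A → A}

/-- Extension of two filters whose product lies in a prime filter `F`. -/
theorem exists_of_mul (hw : ∀ a b c, m a b ≤ c ↔ a ≤ w b c) (hd : ∀ a b c, m a b ≤ c ↔ b ≤ d a c)
    (F : PrimeFilter A) (S T : Set A)
    (hS : S.Nonempty) (upS : ∀ a b, a ≤ b → a ∈ S → b ∈ S)
    (infS : ∀ a b, a ∈ S → b ∈ S → a ⊓ b ∈ S)
    (hT : T.Nonempty) (upT : ∀ a b, a ≤ b → a ∈ T → b ∈ T)
    (infT : ∀ a b, a ∈ T → b ∈ T → a ⊓ b ∈ T)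
    (h : ∀ a ∈ S, ∀ b ∈ T, m a b ∈ F) :
    ∃ G H : PrimeFilter A, (∀ a ∈ S, a ∈ G) ∧ (∀ b ∈ T, b ∈ H) ∧
      ∀ a ∈ G, ∀ b ∈ H, m a b ∈ F := by
  have ml : ∀ {a a' : A} (b), a ≤ a' → m a b ≤ m a' b := fun b h =>
    (hw _ _ _).2 (h.trans ((hw _ _ _).1 le_rfl))
  have mr : ∀ {b b' : A} (a), b ≤ b' → m a b ≤ m a b' := fun a h =>
    (hd _ _ _).2 (h.trans ((hd _ _ _).1 le_rfl))
  obtain ⟨G, hG, hG'⟩ := exists_of_disjoint S {a | ∃ t ∈ T, m a t ∉ F} hS upS infS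
    (by
      obtain ⟨t, ht⟩ := hT
      exact ⟨⊥, t, ht, fun h => F.bot_notMem (F.mem_of_le ((hw _ _ _).2 bot_le) h)⟩)
    (fun a b hab ⟨t, ht, hb⟩ => ⟨t, ht, fun h => hb (F.mem_of_le (ml _ hab) h)⟩)
    (fun a b ⟨s, hs, ha⟩ ⟨t, ht, hb⟩ => ⟨s ⊓ t, infT _ _ hs ht, fun h => by
      have h1 : m (a ⊔ b) (s ⊓ t) ≤ m a s ⊔ m b t := (hw _ _ _).2 (sup_le
        ((hw _ _ _).1 ((mr _ inf_le_left).trans le_sup_left))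
        ((hw _ _ _).1 ((mr _ inf_le_right).trans le_sup_right)))
      exact (F.sup_mem_iff.1 (F.mem_of_le h1 h)).elim ha hb⟩)
    (fun a ha ⟨t, ht, h'⟩ => h' (h a ha t ht))
  have hGT : ∀ a ∈ G, ∀ b ∈ T, m a b ∈ F := fun a ha b hb => by
    by_contra h'
    exact hG' a ⟨b, hb, h'⟩ ha
  obtain ⟨H, hH, hH'⟩ := exists_of_disjoint T {b | ∃ a ∈ G, m a b ∉ F} hT upT infT
    ⟨⊥, ⊤, G.top_mem, fun h => F.bot_notMem (F.mem_of_le ((hd _ _ _).2 bot_le) h)⟩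
    (fun a b hab ⟨t, ht, hb⟩ => ⟨t, ht, fun h => hb (F.mem_of_le (mr _ hab) h)⟩)
    (fun a b ⟨s, hs, ha⟩ ⟨t, ht, hb⟩ => ⟨s ⊓ t, G.inf_mem_iff.2 ⟨hs, ht⟩, fun h => by
      have h1 : m (s ⊓ t) (a ⊔ b) ≤ m s a ⊔ m t b := (hd _ _ _).2 (sup_le
        ((hd _ _ _).1 ((ml _ inf_le_left).trans le_sup_left))
        ((hd _ _ _).1 ((ml _ inf_le_right).trans le_sup_right)))
      exact (F.sup_mem_iff.1 (F.mem_of_le h1 h)).elim ha hb⟩)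
    (fun b hb ⟨a, ha, h'⟩ => h' (hGT a ha b hb))
  exact ⟨G, H, hG, hH, fun a ha b hb => by
    by_contra h'
    exact hH' b ⟨a, ha, h'⟩ hb⟩

/-- Extension of a filter `S` and an ideal `I` with `F * S` disjoint from `I`. -/
theorem exists_of_div (hw : ∀ a b c, m a b ≤ c ↔ a ≤ w b c) (hd : ∀ a b c, m a b ≤ c ↔ b ≤ d a c)
    (F : PrimeFilter A) (S I : Set A)
    (hS : S.Nonempty) (upS : ∀ a b, a ≤ b → a ∈ S → b ∈ S)
    (infS : ∀ a b, a ∈ S → b ∈ S → a ⊓ b ∈ S)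
    (hI : I.Nonempty) (downI : ∀ a b, a ≤ b → b ∈ I → a ∈ I)
    (supI : ∀ a b, a ∈ I → b ∈ I → a ⊔ b ∈ I)
    (h : ∀ a ∈ F, ∀ b ∈ S, m a b ∉ I) :
    ∃ G H : PrimeFilter A, (∀ b ∈ S, b ∈ G) ∧ (∀ c ∈ I, c ∉ H) ∧
      ∀ a ∈ F, ∀ b ∈ G, m a b ∈ H := by
  have ml : ∀ {a a' : A} (b), a ≤ a' → m a b ≤ m a' b := fun b h =>
    (hw _ _ _).2 (h.trans ((hw _ _ _).1 le_rfl))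
  have mr : ∀ {b b' : A} (a), b ≤ b' → m a b ≤ m a b' := fun a h =>
    (hd _ _ _).2 (h.trans ((hd _ _ _).1 le_rfl))
  obtain ⟨G, hG, hG'⟩ := exists_of_disjoint S {b | ∃ a ∈ F, m a b ∈ I} hS upS infS
    (by
      obtain ⟨i, hi⟩ := hI
      exact ⟨⊥, ⊤, F.top_mem, downI _ _ ((hd _ _ _).2 bot_le) hi⟩)
    (fun a b hab ⟨t, ht, hb⟩ => ⟨t, ht, downI _ _ (mr _ hab) hb⟩)
    (fun a b ⟨s, hs, ha⟩ ⟨t, ht, hb⟩ => ⟨s ⊓ t, F.inf_mem_iff.2 ⟨hs, ht⟩, by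
      have h1 : m (s ⊓ t) (a ⊔ b) ≤ m s a ⊔ m t b := (hd _ _ _).2 (sup_le
        ((hd _ _ _).1 ((ml _ inf_le_left).trans le_sup_left))
        ((hd _ _ _).1 ((ml _ inf_le_right).trans le_sup_right)))
      exact downI _ _ h1 (supI _ _ ha hb)⟩)
    (fun b hb ⟨a, ha, h'⟩ => h a ha b hb h')
  obtain ⟨H, hH, hH'⟩ := exists_of_disjoint {u | ∃ a ∈ F, ∃ b ∈ G, m a b ≤ u} I
    ⟨⊤, ⊤, F.top_mem, ⊤, G.top_mem, le_top⟩
    (fun a b hab ⟨s, hs, t, ht, h'⟩ => ⟨s, hs, t, ht, h'.trans hab⟩)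
    (fun a b ⟨s, hs, t, ht, h1⟩ ⟨s', hs', t', ht', h2⟩ =>
      ⟨s ⊓ s', F.inf_mem_iff.2 ⟨hs, hs'⟩, t ⊓ t', G.inf_mem_iff.2 ⟨ht, ht'⟩, le_inf
        (((ml _ inf_le_left).trans (mr _ inf_le_left)).trans h1)
        (((ml _ inf_le_right).trans (mr _ inf_le_right)).trans h2)⟩)
    hI downI supI
    (fun u ⟨a, ha, b, hb, hu⟩ hu' => hG' b ⟨a, ha, downI _ _ hu hu'⟩ hb)
  exact ⟨G, H, hG, hH', fun a ha b hb => hH _ ⟨a, ha, b, hb, le_rfl⟩⟩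

end Separation

/-! ### The topology of prime filters -/

section Topology

theorem isClopen_theta {A : Type*} [Preorder A] (a : A) : IsClopen (theta a) :=
  ⟨⟨isOpen_generateFrom_of_mem (.inr ⟨a, rfl⟩)⟩, isOpen_generateFrom_of_mem (.inl ⟨a, rfl⟩)⟩

theorem isUpperSet_theta {A : Type*} [Preorder A] (a : A) : IsUpperSet (theta a) :=
  fun _ _ h ha => h ha

variable {A : Type*} [Lattice A] [BoundedOrder A]

theorem exists_basic_of_isOpen {U : Set (PrimeFilter A)} (hU : IsOpen U) (F : PrimeFilter A)
    (hF : F ∈ U) : ∃ a b, F ∈ theta a \ theta b ∧ theta a \ theta b ⊆ U := by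
  induction hU with
  | basic s hs =>
    rcases hs with ⟨a, rfl⟩ | ⟨b, rfl⟩
    · exact ⟨a, ⊥, ⟨hF, F.bot_notMem⟩, fun G hG => hG.1⟩
    · exact ⟨⊤, b, ⟨F.top_mem, hF⟩, fun G hG => hG.2⟩
  | univ => exact ⟨⊤, ⊥, ⟨F.top_mem, F.bot_notMem⟩, fun G hG => trivial⟩
  | inter s t _ _ h1 h2 =>
    obtain ⟨a, b, ⟨ha, hb⟩, h⟩ := h1 hF.1
    obtain ⟨a', b', ⟨ha', hb'⟩, h'⟩ := h2 hF.2
    refine ⟨a ⊓ a', b ⊔ b', ⟨F.inf_mem_iff.2 ⟨ha, ha'⟩, fun hs => ?_⟩, ?_⟩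
    · exact (F.sup_mem_iff.1 hs).elim hb hb'
    · rintro G ⟨h1, h2⟩
      exact ⟨h ⟨(G.inf_mem_iff.1 h1).1, fun hh => h2 (G.sup_mem_iff.2 (.inl hh))⟩,
        h' ⟨(G.inf_mem_iff.1 h1).2, fun hh => h2 (G.sup_mem_iff.2 (.inr hh))⟩⟩
  | sUnion S _ ih =>
    obtain ⟨s, hs, hFs⟩ := hF
    obtain ⟨a, b, h1, h2⟩ := ih s hs hFs
    exact ⟨a, b, h1, h2.trans (Set.subset_sUnion_of_mem hs)⟩

instance : CompactSpace (PrimeFilter A) := by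
  refine ⟨isCompact_iff_ultrafilter_le_nhds.2 fun 𝒰 _ => ?_⟩
  let L : PrimeFilter A := ofSet {a | theta a ∈ 𝒰}
    (Filter.mem_of_superset Filter.univ_mem fun F _ => F.top_mem)
    (fun h => by
      obtain ⟨F, hF⟩ := 𝒰.nonempty_of_mem h
      exact F.bot_notMem hF)
    (fun a b hab h => Filter.mem_of_superset h fun F hF => F.mem_of_le hab hF)
    (fun a b ha hb => Filter.mem_of_superset (Filter.inter_mem ha hb) fun F hF =>
      F.inf_mem_iff.2 hF)
    (fun a b h => by
      have h' : theta a ∪ theta b ∈ 𝒰 := Filter.mem_of_superset h fun F hF => F.sup_mem_iff.1 hF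
      exact Ultrafilter.union_mem_iff.1 h')
  refine ⟨L, trivial, ?_⟩
  rw [nhds_generateFrom]
  refine le_iInf₂ fun s hs => ?_
  rw [Filter.le_principal_iff]
  obtain ⟨hL, ⟨a, rfl⟩ | ⟨a, rfl⟩⟩ := hs
  · exact hL
  · exact Ultrafilter.compl_mem_iff_notMem.2 hL

instance : PriestleySpace (PrimeFilter A) where
  priestley {F G} h := by
    obtain ⟨a, ha, hb⟩ := Set.not_subset.1 h
    exact ⟨theta a, isClopen_theta a, isUpperSet_theta a, ha, hb⟩

/-- Every clopen upper set of prime filters is of the form `theta a`. -/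
theorem exists_eq_theta {U : Set (PrimeFilter A)} (hU : IsClopen U) (hU' : IsUpperSet U) :
    ∃ a, U = theta a := by
  have key : ∀ F ∈ U, ∃ a ∈ F, theta a ⊆ U := by
    intro F hF
    have h := hU.compl.isClosed.isCompact.induction_on
      (p := fun s => ∃ a ∈ F, ∀ G ∈ s, a ∉ G) ⟨⊤, F.top_mem, fun _ h => h.elim⟩
      (fun s t hst ⟨a, ha, h⟩ => ⟨a, ha, fun G hG => h G (hst hG)⟩)
      (fun s t ⟨a, ha, h⟩ ⟨b, hb, h'⟩ => ⟨a ⊓ b, F.inf_mem_iff.2 ⟨ha, hb⟩, fun G hG hab =>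
        hG.elim (fun hG => h G hG (G.inf_mem_iff.1 hab).1)
          (fun hG => h' G hG (G.inf_mem_iff.1 hab).2)⟩)
      (fun G hG => by
        have hFG : ¬F ≤ G := fun h => hG (hU' h hF)
        obtain ⟨a, ha, hb⟩ := Set.not_subset.1 hFG
        exact ⟨(theta a)ᶜ, mem_nhdsWithin_of_mem_nhds
          ((isClopen_theta a).compl.isOpen.mem_nhds hb), a, ha, fun _ h => h⟩)
    obtain ⟨a, ha, h⟩ := h
    exact ⟨a, ha, fun G hG => by
      by_contra hGU
      exact h G hGU hG⟩
  have h := hU.isClosed.isCompact.induction_on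
    (p := fun s => ∃ a, s ⊆ theta a ∧ theta a ⊆ U)
    ⟨⊥, Set.empty_subset _, fun G hG => (G.bot_notMem hG).elim⟩
    (fun s t hst ⟨a, h, h'⟩ => ⟨a, hst.trans h, h'⟩)
    (fun s t ⟨a, h1, h2⟩ ⟨b, h3, h4⟩ => ⟨a ⊔ b,
      Set.union_subset (fun G hG => G.sup_mem_iff.2 (.inl (h1 hG)))
        (fun G hG => G.sup_mem_iff.2 (.inr (h3 hG))),
      fun G hG => (G.sup_mem_iff.1 hG).elim (fun h => h2 h) (fun h => h4 h)⟩)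
    (fun F hF => by
      obtain ⟨a, ha, h⟩ := key F hF
      exact ⟨theta a, mem_nhdsWithin_of_mem_nhds ((isClopen_theta a).isOpen.mem_nhds ha),
        a, subset_rfl, h⟩)
  obtain ⟨a, h1, h2⟩ := h
  exact ⟨a, h1.antisymm h2⟩

end Topology

section Heyting

variable {A : Type*} [HeytingAlgebra A]

theorem exists_le_of_himp_notMem {F : PrimeFilter A} {a b : A} (h : a ⇨ b ∉ F) :
    ∃ G : PrimeFilter A, F ≤ G ∧ a ∈ G ∧ b ∉ G := by
  obtain ⟨G, h1, h2⟩ := exists_of_disjoint {c | ∃ x ∈ F, x ⊓ a ≤ c} (Set.Iic b)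
    ⟨⊤, ⊤, F.top_mem, le_top⟩ (fun c c' h ⟨x, hx, h'⟩ => ⟨x, hx, h'.trans h⟩)
    (fun c c' ⟨x, hx, h1⟩ ⟨y, hy, h2⟩ => ⟨x ⊓ y, F.inf_mem_iff.2 ⟨hx, hy⟩, le_inf
      ((inf_le_inf_right _ inf_le_left).trans h1) ((inf_le_inf_right _ inf_le_right).trans h2)⟩)
    ⟨b, le_rfl⟩ (fun _ _ h h' => le_trans h (Set.mem_Iic.1 h')) (fun _ _ h h' => sup_le h h')
    (fun c ⟨x, hx, hc⟩ hc' => h (F.mem_of_le (le_himp_iff.2 (hc.trans hc')) hx))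
  exact ⟨G, fun x hx => h1 x ⟨x, hx, inf_le_left⟩, h1 a ⟨⊤, F.top_mem, inf_le_right⟩,
    h2 b le_rfl⟩

theorem theta_himp (a b : A) : theta (a ⇨ b) = ILGL.himp (theta a) (theta b) := by
  ext F
  constructor
  · intro h G hFG ha
    exact G.mem_of_le (himp_inf_le) (G.inf_mem_iff.2 ⟨hFG h, ha⟩)
  · intro h
    by_contra h'
    obtain ⟨G, h1, h2, h3⟩ := exists_le_of_himp_notMem h'
    exact h3 (h G h1 h2)

instance : EsakiaSpace (PrimeFilter A) where
  isClopen_lowerClosure U hU := by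
    have h := hU.isClosed.isCompact.induction_on
      (p := fun s => ∃ V, s ⊆ V ∧ V ⊆ U ∧ IsClopen (lowerClosure V : Set (PrimeFilter A)))
      ⟨∅, subset_rfl, Set.empty_subset _, by simp [isClopen_empty]⟩
      (fun s t hst ⟨V, h1, h2⟩ => ⟨V, hst.trans h1, h2⟩)
      (fun s t ⟨V, h1, h2, h3⟩ ⟨W, h4, h5, h6⟩ => ⟨V ∪ W, Set.union_subset_union h1 h4,
        Set.union_subset h2 h5, by
          rw [lowerClosure_union, LowerSet.coe_sup]
          exact h3.union h6⟩)
      (fun F hF => by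
        obtain ⟨a, b, hab, h⟩ := exists_basic_of_isOpen hU.isOpen F hF
        refine ⟨theta a \ theta b, mem_nhdsWithin_of_mem_nhds
          (((isClopen_theta a).diff (isClopen_theta b)).isOpen.mem_nhds hab),
          theta a \ theta b, subset_rfl, h, ?_⟩
        have h' : (lowerClosure (theta a \ theta b) : Set (PrimeFilter A)) = (theta (a ⇨ b))ᶜ := by
          rw [theta_himp]
          ext G
          simp only [ILGL.himp, Set.mem_ofPred_eq, Set.mem_compl_iff, SetLike.mem_coe,
            mem_lowerClosure, Set.mem_sdiff, not_forall]
          exact ⟨fun ⟨H, h, h'⟩ => ⟨H, h', h.1, h.2⟩, fun ⟨H, h, h', h''⟩ => ⟨H, ⟨h', h''⟩, h⟩⟩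
        rw [h']
        exact (isClopen_theta _).compl)
    obtain ⟨V, h1, h2, h3⟩ := h
    rwa [h2.antisymm h1] at h3

variable [LayeredOps A]

theorem star_mono {a a' b b' : A} (h : a ≤ a') (h' : b ≤ b') : star a b ≤ star a' b' :=
  (star_le_iff_le_wand _ _ _).2 (h.trans ((star_le_iff_le_wand _ _ _).1
    ((star_le_iff_le_dnaw _ _ _).2 (h'.trans ((star_le_iff_le_dnaw _ _ _).1 le_rfl)))))

theorem theta_star (a b : A) : theta (star a b) = ILGL.bullet (theta a) (theta b) := by
  ext F
  constructor
  · intro h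
    obtain ⟨G, H, h1, h2, h3⟩ := exists_of_mul star_le_iff_le_wand star_le_iff_le_dnaw F
      (Set.Ici a) (Set.Ici b)
      ⟨a, le_rfl⟩ (fun _ _ h h' => le_trans (Set.mem_Ici.1 h') h) (fun _ _ h h' => le_inf h h')
      ⟨b, le_rfl⟩ (fun _ _ h h' => le_trans (Set.mem_Ici.1 h') h) (fun _ _ h h' => le_inf h h')
      (fun c hc e he => F.mem_of_le
        ((star_le_iff_le_wand _ _ _).2 (le_trans hc ((star_le_iff_le_wand _ _ _).1
          ((star_le_iff_le_dnaw _ _ _).2 (le_trans he ((star_le_iff_le_dnaw _ _ _).1 le_rfl))))))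
        h)
    exact ⟨F, G, H, le_rfl, h3, h1 a le_rfl, h2 b le_rfl⟩
  · rintro ⟨W, G, H, h, h1, h2, h3⟩
    exact h (h1 a h2 b h3)

theorem theta_wand (a b : A) : theta (wand a b) = ILGL.bulletWand (theta a) (theta b) := by
  ext F
  constructor
  · intro h W G H hW hH ha
    exact H.mem_of_le ((star_le_iff_le_wand _ _ _).2 le_rfl) (hH _ (hW h) _ ha)
  · intro h
    by_contra h'
    obtain ⟨G, H, h1, h2, h3⟩ := exists_of_div star_le_iff_le_wand star_le_iff_le_dnaw F
      (Set.Ici a) (Set.Iic b)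
      ⟨a, le_rfl⟩ (fun _ _ h h' => le_trans (Set.mem_Ici.1 h') h) (fun _ _ h h' => le_inf h h')
      ⟨b, le_rfl⟩ (fun _ _ h h' => le_trans h (Set.mem_Iic.1 h')) (fun _ _ h h' => sup_le h h')
      (fun c hc e he hce => h' (F.mem_of_le ((star_le_iff_le_wand _ _ _).1
        ((star_le_iff_le_dnaw _ _ _).2 (le_trans he ((star_le_iff_le_dnaw _ _ _).1 hce)))) hc))
    exact h2 b le_rfl (h F G H le_rfl h3 (h1 a le_rfl))

theorem theta_dnaw (a b : A) : theta (dnaw a b) = ILGL.bulletDnaw (theta a) (theta b) := by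
  ext F
  constructor
  · intro h W G H hW hH ha
    exact H.mem_of_le ((star_le_iff_le_dnaw _ _ _).2 le_rfl) (hH _ ha _ (hW h))
  · intro h
    by_contra h'
    obtain ⟨G, H, h1, h2, h3⟩ := exists_of_div (m := fun x y : A => star y x)
      (fun a b c => star_le_iff_le_dnaw b a c) (fun a b c => star_le_iff_le_wand b a c) F
      (Set.Ici a) (Set.Iic b)
      ⟨a, le_rfl⟩ (fun _ _ h h' => le_trans (Set.mem_Ici.1 h') h) (fun _ _ h h' => le_inf h h')
      ⟨b, le_rfl⟩ (fun _ _ h h' => le_trans h (Set.mem_Iic.1 h')) (fun _ _ h h' => sup_le h h')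
      (fun c hc e he hce => h' (F.mem_of_le ((star_le_iff_le_dnaw _ _ _).1
        ((star_le_iff_le_wand _ _ _).2 (le_trans he ((star_le_iff_le_wand _ _ _).1 hce)))) hc))
    exact h2 b le_rfl (h F G H le_rfl (fun x hx y hy => h3 y hy x hx) (h1 a le_rfl))

instance : ILGLSpace (PrimeFilter A) where
  isClopen_bullet U V hU hU' hV hV' := by
    obtain ⟨a, rfl⟩ := exists_eq_theta hU hU'
    obtain ⟨b, rfl⟩ := exists_eq_theta hV hV'
    exact theta_star a b ▸ isClopen_theta _
  isClopen_bulletWand U V hU hU' hV hV' := by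
    obtain ⟨a, rfl⟩ := exists_eq_theta hU hU'
    obtain ⟨b, rfl⟩ := exists_eq_theta hV hV'
    exact theta_wand a b ▸ isClopen_theta _
  isClopen_bulletDnaw U V hU hU' hV hV' := by
    obtain ⟨a, rfl⟩ := exists_eq_theta hU hU'
    obtain ⟨b, rfl⟩ := exists_eq_theta hV hV'
    exact theta_dnaw a b ▸ isClopen_theta _
  exists_separating F G H h := by
    have h' : ∃ a ∈ G, ∃ b ∈ H, star a b ∉ F := by
      by_contra! h'
      exact h h'
    obtain ⟨a, ha, b, hb, hF⟩ := h'
    exact ⟨theta a, theta b, isClopen_theta a, isUpperSet_theta a, isClopen_theta b,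
      isUpperSet_theta b, ha, hb, theta_star a b ▸ hF⟩

/-! ### Preimages of prime filters -/

variable {B : Type*} [HeytingAlgebra B] [LayeredOps B] (f : LayeredHom A B)

/-- The preimage of a prime filter under a homomorphism. -/
def comap (F : PrimeFilter B) : PrimeFilter A :=
  ofSet {a | f.toHeytingHom a ∈ F}
    (by
      rw [Set.mem_ofPred_eq, map_top]
      exact F.top_mem)
    (by
      rw [Set.mem_ofPred_eq, map_bot]
      exact F.bot_notMem)
    (fun a b h h' => F.mem_of_le (OrderHomClass.mono f.toHeytingHom h) h')
    (fun a b ha hb => by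
      rw [Set.mem_ofPred_eq, map_inf]
      exact F.inf_mem_iff.2 ⟨ha, hb⟩)
    (fun a b h => by
      rw [Set.mem_ofPred_eq, map_sup] at h
      exact F.sup_mem_iff.1 h)

theorem mem_comap {F : PrimeFilter B} {a : A} : a ∈ comap f F ↔ f.toHeytingHom a ∈ F := Iff.rfl

theorem exists_comap_eq {F : PrimeFilter B} {G : PrimeFilter A} (h : comap f F ≤ G) :
    ∃ H, F ≤ H ∧ comap f H = G := by
  obtain ⟨H, h1, h2⟩ := exists_of_disjoint
    {u | ∃ x ∈ F, ∃ g ∈ G, x ⊓ f.toHeytingHom g ≤ u} {u | ∃ c, c ∉ G ∧ u ≤ f.toHeytingHom c}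
    ⟨⊤, ⊤, F.top_mem, ⊤, G.top_mem, le_top⟩
    (fun _ _ h ⟨x, hx, g, hg, h'⟩ => ⟨x, hx, g, hg, h'.trans h⟩)
    (fun _ _ ⟨x, hx, g, hg, h1⟩ ⟨y, hy, k, hk, h2⟩ => ⟨x ⊓ y, F.inf_mem_iff.2 ⟨hx, hy⟩,
      g ⊓ k, G.inf_mem_iff.2 ⟨hg, hk⟩, by
        rw [map_inf]
        exact le_inf ((inf_le_inf inf_le_left inf_le_left).trans h1)
          ((inf_le_inf inf_le_right inf_le_right).trans h2)⟩)
    ⟨⊥, ⊥, G.bot_notMem, bot_le⟩ (fun _ _ h ⟨c, hc, h'⟩ => ⟨c, hc, h.trans h'⟩)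
    (fun _ _ ⟨c, hc, h1⟩ ⟨e, he, h2⟩ => ⟨c ⊔ e, fun h => (G.sup_mem_iff.1 h).elim hc he, by
      rw [map_sup]
      exact sup_le_sup h1 h2⟩)
    (fun _ ⟨x, hx, g, hg, h1⟩ ⟨c, hc, h2⟩ => by
      have h3 : g ⇨ c ∈ G := h (show f.toHeytingHom (g ⇨ c) ∈ F by
        rw [map_himp]
        exact F.mem_of_le (le_himp_iff.2 (h1.trans h2)) hx)
      exact hc (G.mem_of_le himp_inf_le (G.inf_mem_iff.2 ⟨h3, hg⟩)))
  refine ⟨H, fun x hx => h1 x ⟨x, hx, ⊤, G.top_mem, inf_le_left⟩, le_antisymm ?_ ?_⟩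
  · intro a ha
    by_contra h'
    exact h2 _ ⟨a, h', le_rfl⟩ ha
  · intro a ha
    exact h1 _ ⟨⊤, F.top_mem, a, ha, inf_le_right⟩

theorem comap_mem_comp {F G H : PrimeFilter B} (h : F ∈ comp G H) :
    comap f F ∈ comp (comap f G) (comap f H) := by
  intro a ha b hb
  have h1 : f.toHeytingHom (star a b) = _ := f.map_star a b
  rw [mem_comap, h1]
  exact h _ ha _ hb

theorem image_inf (G : PrimeFilter A) (a b : B) (ha : ∃ g ∈ G, f.toHeytingHom g ≤ a)
    (hb : ∃ g ∈ G, f.toHeytingHom g ≤ b) : ∃ g ∈ G, f.toHeytingHom g ≤ a ⊓ b := by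
  obtain ⟨g, hg, h1⟩ := ha
  obtain ⟨k, hk, h2⟩ := hb
  refine ⟨g ⊓ k, G.inf_mem_iff.2 ⟨hg, hk⟩, ?_⟩
  rw [map_inf]
  exact inf_le_inf h1 h2

theorem image_sup (G : PrimeFilter A) (a b : B) (ha : ∃ g, g ∉ G ∧ a ≤ f.toHeytingHom g)
    (hb : ∃ g, g ∉ G ∧ b ≤ f.toHeytingHom g) : ∃ g, g ∉ G ∧ a ⊔ b ≤ f.toHeytingHom g := by
  obtain ⟨g, hg, h1⟩ := ha
  obtain ⟨k, hk, h2⟩ := hb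
  refine ⟨g ⊔ k, fun h => (G.sup_mem_iff.1 h).elim hg hk, ?_⟩
  rw [map_sup]
  exact sup_le_sup h1 h2

theorem exists_of_comap_mem_comp {F : PrimeFilter B} {G H : PrimeFilter A}
    (h : comap f F ∈ comp G H) : ∃ G' H', F ∈ comp G' H' ∧ G ≤ comap f G' ∧ H ≤ comap f H' := by
  obtain ⟨G', H', h1, h2, h3⟩ := exists_of_mul star_le_iff_le_wand star_le_iff_le_dnaw F
    {u | ∃ g ∈ G, f.toHeytingHom g ≤ u} {u | ∃ g ∈ H, f.toHeytingHom g ≤ u}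
    ⟨⊤, ⊤, G.top_mem, le_top⟩ (fun _ _ h ⟨g, hg, h'⟩ => ⟨g, hg, h'.trans h⟩) (image_inf f G)
    ⟨⊤, ⊤, H.top_mem, le_top⟩ (fun _ _ h ⟨g, hg, h'⟩ => ⟨g, hg, h'.trans h⟩) (image_inf f H)
    (fun a ⟨g, hg, ha⟩ b ⟨k, hk, hb⟩ => by
      have h4 : f.toHeytingHom (star g k) ∈ F := h g hg k hk
      have h5 : f.toHeytingHom (star g k) = _ := f.map_star g k
      rw [h5] at h4
      exact F.mem_of_le (star_mono ha hb) h4)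
  exact ⟨G', H', h3, fun a ha => h1 _ ⟨a, ha, le_rfl⟩, fun a ha => h2 _ ⟨a, ha, le_rfl⟩⟩

theorem exists_of_mem_comp_left {F : PrimeFilter B} {G H : PrimeFilter A}
    (h : H ∈ comp (comap f F) G) : ∃ G' H', H' ∈ comp F G' ∧ G ≤ comap f G' ∧ comap f H' ≤ H := by
  obtain ⟨G', H', h1, h2, h3⟩ := exists_of_div star_le_iff_le_wand star_le_iff_le_dnaw F
    {u | ∃ g ∈ G, f.toHeytingHom g ≤ u} {u | ∃ c, c ∉ H ∧ u ≤ f.toHeytingHom c}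
    ⟨⊤, ⊤, G.top_mem, le_top⟩ (fun _ _ h ⟨g, hg, h'⟩ => ⟨g, hg, h'.trans h⟩) (image_inf f G)
    ⟨⊥, ⊥, H.bot_notMem, bot_le⟩ (fun _ _ h ⟨c, hc, h'⟩ => ⟨c, hc, h.trans h'⟩) (image_sup f H)
    (fun a ha b ⟨g, hg, hb⟩ ⟨c, hc, hab⟩ => by
      have h4 : f.toHeytingHom (wand g c) = _ := f.map_wand g c
      have h5 : wand g c ∈ comap f F := by
        rw [mem_comap, h4]
        exact F.mem_of_le ((star_le_iff_le_wand _ _ _).1 ((star_mono le_rfl hb).trans hab)) ha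
      exact hc (H.mem_of_le ((star_le_iff_le_wand _ _ _).2 le_rfl) (h _ h5 g hg)))
  refine ⟨G', H', h3, fun a ha => h1 _ ⟨a, ha, le_rfl⟩, fun c hc => ?_⟩
  by_contra h'
  exact h2 _ ⟨c, h', le_rfl⟩ hc

theorem exists_of_mem_comp_right {F : PrimeFilter B} {G H : PrimeFilter A}
    (h : H ∈ comp G (comap f F)) : ∃ G' H', H' ∈ comp G' F ∧ G ≤ comap f G' ∧ comap f H' ≤ H := by
  obtain ⟨G', H', h1, h2, h3⟩ := exists_of_div (m := fun x y : B => star y x)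
    (fun a b c => star_le_iff_le_dnaw b a c) (fun a b c => star_le_iff_le_wand b a c) F
    {u | ∃ g ∈ G, f.toHeytingHom g ≤ u} {u | ∃ c, c ∉ H ∧ u ≤ f.toHeytingHom c}
    ⟨⊤, ⊤, G.top_mem, le_top⟩ (fun _ _ h ⟨g, hg, h'⟩ => ⟨g, hg, h'.trans h⟩) (image_inf f G)
    ⟨⊥, ⊥, H.bot_notMem, bot_le⟩ (fun _ _ h ⟨c, hc, h'⟩ => ⟨c, hc, h.trans h'⟩) (image_sup f H)
    (fun a ha b ⟨g, hg, hb⟩ ⟨c, hc, hab⟩ => by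
      have h4 : f.toHeytingHom (dnaw g c) = _ := f.map_dnaw g c
      have h5 : dnaw g c ∈ comap f F := by
        rw [mem_comap, h4]
        exact F.mem_of_le ((star_le_iff_le_dnaw _ _ _).1 ((star_mono hb le_rfl).trans hab)) ha
      exact hc (H.mem_of_le ((star_le_iff_le_dnaw _ _ _).2 le_rfl) (h g hg _ h5)))
  refine ⟨G', H', fun x hx y hy => h3 y hy x hx, fun a ha => h1 _ ⟨a, ha, le_rfl⟩, fun c hc => ?_⟩
  by_contra h'
  exact h2 _ ⟨c, h', le_rfl⟩ hc

theorem continuous_comap : Continuous (comap f) := by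
  refine continuous_generateFrom_iff.2 ?_
  rintro s (⟨a, rfl⟩ | ⟨a, rfl⟩)
  · exact (isClopen_theta (f.toHeytingHom a)).isOpen
  · exact (isClopen_theta (f.toHeytingHom a)).compl.isOpen

/-- The morphism of ILGL spaces induced by a homomorphism of ILGL algebras. -/
def comapILGL : ILGLMap (PrimeFilter B) (PrimeFilter A) where
  toFun := comap f
  monotone' _ _ h _ ha := h ha
  continuous_toFun := continuous_comap f
  exists_map_eq_of_map_le' _ _ h := exists_comap_eq f h
  map_comp _ _ _ h := comap_mem_comp f h
  exists_of_bullet F W G H hW h := by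
    obtain ⟨G', H', h1, h2, h3⟩ := exists_of_comap_mem_comp f (F := F) (G := G) (H := H)
      (fun a ha b hb => hW (h a ha b hb))
    exact ⟨F, G', H', le_rfl, h1, h2, h3⟩
  exists_of_bulletWand F W G H hW h := by
    obtain ⟨G', H', h1, h2, h3⟩ := exists_of_mem_comp_left f (F := F) (G := G) (H := H)
      (fun a ha b hb => h a (hW ha) b hb)
    exact ⟨F, G', H', le_rfl, h1, h2, h3⟩
  exists_of_bulletDnaw F W G H hW h := by
    obtain ⟨G', H', h1, h2, h3⟩ := exists_of_mem_comp_right f (F := F) (G := G) (H := H)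
      (fun a ha b hb => h a ha b (hW hb))
    exact ⟨F, G', H', le_rfl, h1, h2, h3⟩

end Heyting

section Boolean

variable {A : Type*} [BooleanAlgebra A]

theorem compl_mem_iff (F : PrimeFilter A) (a : A) : aᶜ ∈ F ↔ a ∉ F := by
  constructor
  · intro h h'
    have h1 := F.inf_mem_iff.2 ⟨h', h⟩
    rw [inf_compl_eq_bot] at h1
    exact F.bot_notMem h1
  · intro h
    have h1 : a ⊔ aᶜ ∈ F := by
      rw [sup_compl_eq_top]
      exact F.top_mem
    exact (F.sup_mem_iff.1 h1).resolve_left h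

/-- Inclusion of prime filters of a Boolean algebra is equality. -/
theorem eq_of_le {F G : PrimeFilter A} (h : F ≤ G) : F = G := by
  refine le_antisymm h fun a ha => ?_
  by_contra h'
  exact (G.compl_mem_iff a).1 (h ((F.compl_mem_iff a).2 h')) ha

/-- In the Boolean case the sets `theta a` alone form a base of the topology. -/
theorem isTopologicalBasis_theta :
    IsTopologicalBasis (Set.range (theta : A → Set (PrimeFilter A))) := by
  refine isTopologicalBasis_of_isOpen_of_nhds ?_ fun F U hF hU => ?_
  · rintro _ ⟨a, rfl⟩
    exact (isClopen_theta a).isOpen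
  · obtain ⟨a, b, ⟨ha, hb⟩, h⟩ := exists_basic_of_isOpen hU F hF
    exact ⟨_, ⟨a ⊓ bᶜ, rfl⟩, F.inf_mem_iff.2 ⟨ha, (F.compl_mem_iff b).2 hb⟩, fun G hG =>
      h ⟨(G.inf_mem_iff.1 hG).1, (G.compl_mem_iff b).1 (G.inf_mem_iff.1 hG).2⟩⟩

theorem isUpperSet_of_boolean (U : Set (PrimeFilter A)) : IsUpperSet U :=
  fun _ _ h hF => eq_of_le h ▸ hF

variable [LayeredOps A]

theorem bullet_eq (U V : Set (PrimeFilter A)) : LGL.bullet U V = ILGL.bullet U V := by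
  ext F
  constructor
  · rintro ⟨G, hG, H, hH, h⟩
    exact ⟨F, G, H, le_rfl, h, hG, hH⟩
  · rintro ⟨W, G, H, hW, h, hG, hH⟩
    obtain rfl := eq_of_le hW
    exact ⟨G, hG, H, hH, h⟩

theorem bulletWand_eq (U V : Set (PrimeFilter A)) :
    LGL.bulletWand U V = ILGL.bulletWand U V := by
  ext F
  constructor
  · intro h W G H hW
    obtain rfl := eq_of_le hW
    exact h G H
  · exact fun h G H => h F G H le_rfl

theorem bulletDnaw_eq (U V : Set (PrimeFilter A)) :
    LGL.bulletDnaw U V = ILGL.bulletDnaw U V := by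
  ext F
  constructor
  · intro h W G H hW
    obtain rfl := eq_of_le hW
    exact h G H
  · exact fun h G H => h F G H le_rfl

instance : LGLSpace (PrimeFilter A) where
  isClopen_bullet U V hU hV := bullet_eq U V ▸ ILGLSpace.isClopen_bullet U V hU
    (isUpperSet_of_boolean U) hV (isUpperSet_of_boolean V)
  isClopen_bulletWand U V hU hV := bulletWand_eq U V ▸ ILGLSpace.isClopen_bulletWand U V hU
    (isUpperSet_of_boolean U) hV (isUpperSet_of_boolean V)
  isClopen_bulletDnaw U V hU hV := bulletDnaw_eq U V ▸ ILGLSpace.isClopen_bulletDnaw U V hU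
    (isUpperSet_of_boolean U) hV (isUpperSet_of_boolean V)
  exists_separating F G H h := by
    obtain ⟨U, V, hU, _, hV, _, hG, hH, hF⟩ := ILGLSpace.exists_separating F G H h
    exact ⟨U, V, hU, hV, hG, hH, bullet_eq U V ▸ hF⟩

/-- The morphism of LGL spaces induced by a homomorphism of LGL algebras. -/
def comapLGL {B : Type*} [BooleanAlgebra B] [LayeredOps B] (f : LayeredHom A B) :
    LGLMap (PrimeFilter B) (PrimeFilter A) where
  toFun := comap f
  continuous_toFun := continuous_comap f
  map_comp _ _ _ h := comap_mem_comp f h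
  exists_of_bullet F G H h := by
    obtain ⟨G', H', h1, h2, h3⟩ := exists_of_comap_mem_comp f h
    exact ⟨G', H', h1, (eq_of_le h2).symm, (eq_of_le h3).symm⟩
  exists_of_bulletWand F G H h := by
    obtain ⟨G', H', h1, h2, h3⟩ := exists_of_mem_comp_left f h
    exact ⟨G', H', h1, (eq_of_le h2).symm, eq_of_le h3⟩
  exists_of_bulletDnaw F G H h := by
    obtain ⟨G', H', h1, h2, h3⟩ := exists_of_mem_comp_right f h
    exact ⟨G', H', h1, (eq_of_le h2).symm, eq_of_le h3⟩

end Boolean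

end PrimeFilter

/-- The contravariant functor of prime filter spaces of ILGL algebras, with homomorphisms sent to
preimage. -/
def prILGL : ILGLAlg.{u} ⥤ ILGLSp.{u}ᵒᵖ where
  obj A := op ⟨PrimeFilter A.carrier⟩
  map f := Quiver.Hom.op (PrimeFilter.comapILGL f)

/-- The contravariant functor of prime filter spaces of LGL algebras, with homomorphisms sent to
preimage. -/
def prLGL : LGLAlg.{u} ⥤ LGLSp.{u}ᵒᵖ where
  obj A := op ⟨PrimeFilter A.carrier⟩
  map f := Quiver.Hom.op (PrimeFilter.comapLGL f)

end LayeredLogic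

/-! The duality extends Esakia and Stone duality by a composition, and it rests on two bijections.

On the algebra side, `theta` is injective because elements `a`, `b` with `¬a ≤ b` are separated by a
prime filter (`exists_mem_notMem`). It reaches every clopen upper set because the space of prime
filters is compact (`exists_eq_theta`). It respects `*` and its residuals because filters whose
products stay inside a prime filter, or avoid an ideal, extend to prime filters with the same
property (`theta_star`, `theta_wand`, `theta_dnaw`). A bijective homomorphism is an isomorphism,
since all the structure is algebraic.

On the space side, a point goes to the filter of clopen (upper) sets around it. Clopen separation
makes this map injective and, in the ordered case, order-reflecting. Its image is dense, because a
nonempty basic open set `theta U \ theta V` forces `U` not to be contained in `V`, and any point of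
`U` outside `V` lands in it. Compactness then yields surjectivity and a homeomorphism
(`surjective_of_separating`). The separation axiom for the composition is exactly what makes the map
reflect `∘` (`etaILGL_mem_comp_iff`, `etaLGL_mem_comp_iff`). A homeomorphism that preserves and
reflects order and composition satisfies every back condition, hence is an isomorphism of spaces.

Naturality and the triangle identity only unfold the equivalence of `x ∈ g⁻¹(U)` with `g x ∈ U`, so
they hold by definition on elements. In the Boolean case inclusion of prime filters is equality, so
the ordered results about `theta` carry over. -/

namespace LayeredLogic

open FrameComp (comp)

/-! ### Inverses of bijective homomorphisms -/

namespace LayeredHom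

variable {A B : Type*} [HeytingAlgebra A] [LayeredOps A] [HeytingAlgebra B] [LayeredOps B]

/-- The inverse of a bijective homomorphism of layered Heyting algebras. -/
noncomputable def inverse (f : LayeredHom A B) (hf : Function.Bijective f.toFun) :
    LayeredHom B A where
  toFun := (Equiv.ofBijective f.toFun hf).symm
  -- Every operation passes to the inverse in the same way: after the injective `f` is applied, both
  -- sides become the operation on the original elements of `B`.
  map_sup' a b := hf.injective <| by
    rw [f.map_sup']
    simp only [Equiv.ofBijective_apply_symm_apply]
  map_inf' a b := hf.injective <| by
    rw [f.map_inf']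
    simp only [Equiv.ofBijective_apply_symm_apply]
  map_bot' := hf.injective <| by
    rw [f.map_bot']
    simp only [Equiv.ofBijective_apply_symm_apply]
  map_himp' a b := hf.injective <| by
    rw [f.map_himp']
    simp only [Equiv.ofBijective_apply_symm_apply]
  map_star a b := hf.injective <| by
    rw [f.map_star]
    simp only [Equiv.ofBijective_apply_symm_apply]
  map_wand a b := hf.injective <| by
    rw [f.map_wand]
    simp only [Equiv.ofBijective_apply_symm_apply]
  map_dnaw a b := hf.injective <| by
    rw [f.map_dnaw]
    simp only [Equiv.ofBijective_apply_symm_apply]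

theorem ext_toFun {f g : LayeredHom A B} (h : ∀ a, f.toFun a = g.toFun a) : f = g :=
  LayeredHom.ext (funext h)

theorem comp_inverse (f : LayeredHom A B) (hf : Function.Bijective f.toFun) :
    f.comp (f.inverse hf) = LayeredHom.id B :=
  ext_toFun (Equiv.ofBijective f.toFun hf).apply_symm_apply

theorem inverse_comp (f : LayeredHom A B) (hf : Function.Bijective f.toFun) :
    (f.inverse hf).comp f = LayeredHom.id A :=
  ext_toFun (Equiv.ofBijective f.toFun hf).symm_apply_apply

end LayeredHom

/-- Isomorphism of ILGL algebras from a bijective homomorphism. -/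
noncomputable def ILGLAlg.isoOfBijective {A B : ILGLAlg.{u}}
    (f : LayeredHom A.carrier B.carrier) (hf : Function.Bijective f.toFun) : A ≅ B where
  hom := f
  inv := f.inverse hf
  hom_inv_id := f.inverse_comp hf
  inv_hom_id := f.comp_inverse hf

/-- Isomorphism of LGL algebras from a bijective homomorphism. -/
noncomputable def LGLAlg.isoOfBijective {A B : LGLAlg.{u}}
    (f : LayeredHom A.carrier B.carrier) (hf : Function.Bijective f.toFun) : A ≅ B where
  hom := f
  inv := f.inverse hf
  hom_inv_id := f.inverse_comp hf
  inv_hom_id := f.comp_inverse hf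

/-! ### Isomorphisms of spaces -/

theorem ILGLMap.ext_toFun {X Y : Type*} [TopologicalSpace X] [PartialOrder X] [FrameComp X]
    [TopologicalSpace Y] [PartialOrder Y] [FrameComp Y] {f g : ILGLMap X Y}
    (h : ∀ x, f.toFun x = g.toFun x) : f = g :=
  ILGLMap.ext (funext h)

theorem LGLMap.ext_toFun {X Y : Type*} [TopologicalSpace X] [FrameComp X]
    [TopologicalSpace Y] [FrameComp Y] {f g : LGLMap X Y}
    (h : ∀ x, f.toFun x = g.toFun x) : f = g :=
  LGLMap.ext (funext h)

/-- A homeomorphism preserving and reflecting order and composition is a morphism of ILGL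
spaces. -/
def ILGLMap.ofHomeomorph {X Y : Type*} [TopologicalSpace X] [PartialOrder X] [FrameComp X]
    [TopologicalSpace Y] [PartialOrder Y] [FrameComp Y] (e : X ≃ₜ Y)
    (hle : ∀ x y, e x ≤ e y ↔ x ≤ y)
    (hcomp : ∀ x y z, e x ∈ FrameComp.comp (e y) (e z) ↔ x ∈ FrameComp.comp y z) :
    ILGLMap X Y where
  toFun := e
  continuous_toFun := e.continuous
  monotone' x y h := (hle x y).2 h
  exists_map_eq_of_map_le' x y' h :=
    -- The p-morphism condition is order reflection applied to the unique preimage of `y'`.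
    ⟨e.symm y', (hle _ _).1 (by rwa [e.apply_symm_apply]), e.apply_symm_apply y'⟩
  map_comp x y z h := (hcomp x y z).2 h
  exists_of_bullet x w' y' z' h h' := by
    -- All points of the codomain are images, so the back condition holds with equality where only
    -- inequalities are required; the same works for both residuals.
    obtain ⟨w, rfl⟩ := e.surjective w'
    obtain ⟨y, rfl⟩ := e.surjective y'
    obtain ⟨z, rfl⟩ := e.surjective z'
    exact ⟨w, y, z, (hle _ _).1 h, (hcomp _ _ _).1 h', le_rfl, le_rfl⟩
  exists_of_bulletWand x w' y' z' h h' := by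
    obtain ⟨w, rfl⟩ := e.surjective w'
    obtain ⟨y, rfl⟩ := e.surjective y'
    obtain ⟨z, rfl⟩ := e.surjective z'
    exact ⟨w, y, z, (hle _ _).1 h, (hcomp _ _ _).1 h', le_rfl, le_rfl⟩
  exists_of_bulletDnaw x w' y' z' h h' := by
    obtain ⟨w, rfl⟩ := e.surjective w'
    obtain ⟨y, rfl⟩ := e.surjective y'
    obtain ⟨z, rfl⟩ := e.surjective z'
    exact ⟨w, y, z, (hle _ _).1 h, (hcomp _ _ _).1 h', le_rfl, le_rfl⟩

/-- A homeomorphism preserving and reflecting composition is a morphism of LGL spaces. -/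
def LGLMap.ofHomeomorph {X Y : Type*} [TopologicalSpace X] [FrameComp X]
    [TopologicalSpace Y] [FrameComp Y] (e : X ≃ₜ Y)
    (hcomp : ∀ x y z, e x ∈ FrameComp.comp (e y) (e z) ↔ x ∈ FrameComp.comp y z) : LGLMap X Y where
  toFun := e
  continuous_toFun := e.continuous
  map_comp x y z h := (hcomp x y z).2 h
  exists_of_bullet x y' z' h := by
    obtain ⟨y, rfl⟩ := e.surjective y'
    obtain ⟨z, rfl⟩ := e.surjective z'
    exact ⟨y, z, (hcomp _ _ _).1 h, rfl, rfl⟩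
  exists_of_bulletWand x y' z' h := by
    obtain ⟨y, rfl⟩ := e.surjective y'
    obtain ⟨z, rfl⟩ := e.surjective z'
    exact ⟨y, z, (hcomp _ _ _).1 h, rfl, rfl⟩
  exists_of_bulletDnaw x y' z' h := by
    obtain ⟨y, rfl⟩ := e.surjective y'
    obtain ⟨z, rfl⟩ := e.surjective z'
    exact ⟨y, z, (hcomp _ _ _).1 h, rfl, rfl⟩

/-- Isomorphism of ILGL spaces from a homeomorphism preserving and reflecting order and
composition. -/
def ILGLSp.isoOfHomeomorph {X Y : ILGLSp.{u}} (e : X.carrier ≃ₜ Y.carrier)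
    (hle : ∀ x y, e x ≤ e y ↔ x ≤ y)
    (hcomp : ∀ x y z, e x ∈ FrameComp.comp (e y) (e z) ↔ x ∈ FrameComp.comp y z) :
    X ≅ Y where
  hom := ILGLMap.ofHomeomorph e hle hcomp
  inv := ILGLMap.ofHomeomorph e.symm
    (fun x y => by rw [← hle, e.apply_symm_apply, e.apply_symm_apply])
    (fun x y z => by
      rw [← hcomp, e.apply_symm_apply, e.apply_symm_apply, e.apply_symm_apply])
  hom_inv_id := ILGLMap.ext_toFun e.symm_apply_apply
  inv_hom_id := ILGLMap.ext_toFun e.apply_symm_apply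

/-- Isomorphism of LGL spaces from a homeomorphism preserving and reflecting composition. -/
def LGLSp.isoOfHomeomorph {X Y : LGLSp.{u}} (e : X.carrier ≃ₜ Y.carrier)
    (hcomp : ∀ x y z, e x ∈ FrameComp.comp (e y) (e z) ↔ x ∈ FrameComp.comp y z) :
    X ≅ Y where
  hom := LGLMap.ofHomeomorph e hcomp
  inv := LGLMap.ofHomeomorph e.symm
    (fun x y z => by
      rw [← hcomp, e.apply_symm_apply, e.apply_symm_apply, e.apply_symm_apply])
  hom_inv_id := LGLMap.ext_toFun e.symm_apply_apply
  inv_hom_id := LGLMap.ext_toFun e.apply_symm_apply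

/-! ### The representation of algebras -/

namespace PrimeFilter

section Lattice

variable {A : Type*} [Lattice A] [BoundedOrder A]

/-- Joins use primality; the next two lemmas use closure of filters under meets and properness. -/
theorem theta_sup (a b : A) : theta (a ⊔ b) = theta a ∪ theta b :=
  Set.ext fun F => F.sup_mem_iff

theorem theta_inf (a b : A) : theta (a ⊓ b) = theta a ∩ theta b :=
  Set.ext fun F => F.inf_mem_iff

theorem theta_bot : theta (⊥ : A) = ∅ :=
  Set.eq_empty_of_forall_notMem fun F => F.bot_notMem

end Lattice

/-- This is the prime filter theorem, which is why distributivity is assumed: if `¬a ≤ b`, some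
prime filter contains `a` but not `b`. -/
theorem theta_injective {A : Type*} [DistribLattice A] [BoundedOrder A] :
    Function.Injective (theta : A → Set (PrimeFilter A)) := by
  have key : ∀ a b : A, theta a = theta b → a ≤ b := fun a b h => by
    by_contra hab
    obtain ⟨F, ha, hb⟩ := exists_mem_notMem hab
    exact hb (h ▸ ha : F ∈ theta b)
  exact fun a b h => le_antisymm (key a b h) (key b a h.symm)

/-- The representation of an ILGL algebra by clopen upper sets of prime filters. -/
def thetaILGL (A : Type*) [HeytingAlgebra A] [LayeredOps A] :
    LayeredHom A (ClopenUpperSet (PrimeFilter A)) where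
  toFun a := ⟨⟨theta a, isClopen_theta a⟩, isUpperSet_theta a⟩
  map_sup' a b := SetLike.coe_injective (theta_sup a b)
  map_inf' a b := SetLike.coe_injective (theta_inf a b)
  map_bot' := SetLike.coe_injective theta_bot
  map_himp' a b := SetLike.coe_injective (theta_himp a b)
  map_star a b := SetLike.coe_injective (theta_star a b)
  map_wand a b := SetLike.coe_injective (theta_wand a b)
  map_dnaw a b := SetLike.coe_injective (theta_dnaw a b)

/-- Injectivity is separation by prime filters. Surjectivity is compactness: a clopen upper set is a
finite union of sets `theta a`, hence itself of this form. -/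
theorem thetaILGL_bijective (A : Type*) [HeytingAlgebra A] [LayeredOps A] :
    Function.Bijective (thetaILGL A).toFun := by
  refine ⟨fun a b h => theta_injective (congrArg SetLike.coe h), fun U => ?_⟩
  obtain ⟨a, ha⟩ := exists_eq_theta U.isClopen U.upper
  exact ⟨a, SetLike.coe_injective ha.symm⟩

/-- The representation of an LGL algebra by clopen sets of prime filters. -/
def thetaLGL (A : Type*) [BooleanAlgebra A] [LayeredOps A] :
    LayeredHom A (Clopens (PrimeFilter A)) where
  toFun a := ⟨theta a, isClopen_theta a⟩
  map_sup' a b := SetLike.coe_injective (theta_sup a b)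
  map_inf' a b := SetLike.coe_injective (theta_inf a b)
  map_bot' := SetLike.coe_injective theta_bot
  map_himp' a b := by
    -- Both implications are Boolean, so the claim reduces to joins and to `theta aᶜ` being the
    -- complement of `theta a`, which holds because prime filters of a Boolean algebra are
    -- ultrafilters.
    rw [himp_eq, himp_eq]
    refine SetLike.coe_injective ((theta_sup b aᶜ).trans ?_)
    exact congrArg (theta b ∪ ·) (Set.ext fun F => F.compl_mem_iff a)
  -- Inclusion of prime filters is equality here, so the unordered complex operations agree with the
  -- ordered ones.
  map_star a b := SetLike.coe_injective ((theta_star a b).trans (bullet_eq _ _).symm)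
  map_wand a b := SetLike.coe_injective ((theta_wand a b).trans (bulletWand_eq _ _).symm)
  map_dnaw a b := SetLike.coe_injective ((theta_dnaw a b).trans (bulletDnaw_eq _ _).symm)

theorem thetaLGL_bijective (A : Type*) [BooleanAlgebra A] [LayeredOps A] :
    Function.Bijective (thetaLGL A).toFun := by
  refine ⟨fun a b h => theta_injective (congrArg SetLike.coe h), fun U => ?_⟩
  -- The order is discrete, so every clopen set is a clopen upper set.
  obtain ⟨a, ha⟩ := exists_eq_theta U.isClopen (isUpperSet_of_boolean _)
  exact ⟨a, SetLike.coe_injective ha.symm⟩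

/-! ### The representation of spaces -/

/-- The subbase consists of the sets `theta a` and their complements; clopen preimages handle both
kinds at once. -/
theorem continuous_of_isClopen_preimage {X A : Type*} [TopologicalSpace X] [Preorder A]
    {e : X → PrimeFilter A} (h : ∀ a, IsClopen (e ⁻¹' theta a)) : Continuous e := by
  refine continuous_generateFrom_iff.2 ?_
  rintro s (⟨a, rfl⟩ | ⟨a, rfl⟩)
  · exact (h a).isOpen
  · exact (h a).compl.isOpen

/-- A continuous map from a compact space to a space of prime filters is surjective once its image
separates the elements of the lattice. -/
theorem surjective_of_separating {X A : Type*} [TopologicalSpace X] [CompactSpace X] [Lattice A]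
    [BoundedOrder A] {e : X → PrimeFilter A} (he : Continuous e)
    (h : ∀ a b, (∀ x, a ∈ e x → b ∈ e x) → a ≤ b) : Function.Surjective e := by
  have hd : DenseRange e := by
    -- If the image missed a basic neighbourhood `theta a \ theta b` of `F`, then every `e x`
    -- containing `a` would contain `b`. The hypothesis would give `a ≤ b`, although `F` contains
    -- `a` and not `b`.
    refine dense_iff_inter_open.2 fun U hU ⟨F, hF⟩ => ?_
    obtain ⟨a, b, ⟨ha, hb⟩, hab⟩ := exists_basic_of_isOpen hU F hF
    by_contra hne
    refine hb (F.mem_of_le (h a b fun x hx => ?_) ha)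
    by_contra hx'
    exact hne ⟨e x, hab ⟨hx, hx'⟩, x, rfl⟩
  -- The compact image is closed because the space of prime filters is Hausdorff, and a closed dense
  -- set is everything.
  rw [← Set.range_eq_univ, ← (isCompact_range he).isClosed.closure_eq]
  exact hd.closure_eq

/-! ### Points of an Esakia space as prime filters of clopen upper sets -/

section ILGL

variable {X : Type*} [TopologicalSpace X] [PartialOrder X]

/-- The prime filter of clopen upper sets containing a point. -/
def etaILGL (x : X) : PrimeFilter (ClopenUpperSet X) :=
  -- Lattice operations are set operations, so each filter axiom is definitional; primality says
  -- that membership in a union is a disjunction.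
  ofSet {U | x ∈ U} trivial id (fun _ _ h hx => h hx) (fun _ _ h h' => ⟨h, h'⟩) (fun _ _ h => h)

/-- Reflection of the order is Priestley separation; preservation holds because the sets are upper
sets. -/
theorem etaILGL_le_iff [PriestleySpace X] {x y : X} : etaILGL x ≤ etaILGL y ↔ x ≤ y := by
  refine ⟨fun h => ?_, fun h U hU => U.upper h hU⟩
  by_contra hxy
  obtain ⟨U, hU, hU', hx, hy⟩ := exists_isClopen_upper_of_not_le hxy
  exact hy (@h ⟨⟨U, hU⟩, hU'⟩ hx)

/-- The preimage of `theta U` is `U` itself. -/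
theorem continuous_etaILGL : Continuous (etaILGL : X → _) :=
  continuous_of_isClopen_preimage fun U => U.isClopen

/-- Injectivity follows from order reflection by antisymmetry. For surjectivity, the separation
hypothesis merely says that inclusion of clopen upper sets is tested on points. -/
theorem etaILGL_bijective [EsakiaSpace X] : Function.Bijective (etaILGL : X → _) :=
  ⟨fun _ _ h => le_antisymm (etaILGL_le_iff.1 h.le) (etaILGL_le_iff.1 h.ge),
    surjective_of_separating continuous_etaILGL fun _ _ h x hx => h x hx⟩

/-- Reflection is where the separation axiom for `∘` enters: if `x ∉ y ∘ z`, it supplies `U ∋ y` and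
`V ∋ z` with `x` outside their product, which contradicts membership in the composite of filters. -/
theorem etaILGL_mem_comp_iff [FrameComp X] [ILGLSpace X] {x y z : X} :
    etaILGL x ∈ comp (etaILGL y) (etaILGL z) ↔ x ∈ comp y z := by
  refine ⟨fun h => ?_, fun h U hy V hz => ⟨x, y, z, le_rfl, h, hy, hz⟩⟩
  by_contra hx
  obtain ⟨U, V, hU, hU', hV, hV', hy, hz, hx'⟩ := ILGLSpace.exists_separating x y z hx
  exact hx' (h ⟨⟨U, hU⟩, hU'⟩ hy ⟨⟨V, hV⟩, hV'⟩ hz)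

variable (X) in
/-- The homeomorphism of an Esakia space with the prime filters of its clopen upper sets. -/
noncomputable def etaILGLHomeomorph [EsakiaSpace X] : X ≃ₜ PrimeFilter (ClopenUpperSet X) :=
  -- The target is Hausdorff because it is a Priestley space.
  Continuous.homeoOfEquivCompactToT2 (f := Equiv.ofBijective etaILGL etaILGL_bijective)
    continuous_etaILGL

end ILGL

/-! ### Points of a Stone space as prime filters of clopen sets -/

section LGL

variable {X : Type*} [TopologicalSpace X]

/-- The prime filter of clopen sets containing a point. -/
def etaLGL (x : X) : PrimeFilter (Clopens X) :=
  ofSet {U | x ∈ U} trivial id (fun _ _ h hx => h hx) (fun _ _ h h' => ⟨h, h'⟩) (fun _ _ h => h)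

theorem continuous_etaLGL : Continuous (etaLGL : X → _) :=
  continuous_of_isClopen_preimage fun U => U.isClopen

variable [FrameComp X] [LGLSpace X]

theorem etaLGL_bijective : Function.Bijective (etaLGL : X → _) := by
  refine ⟨fun x y h => ?_,
    surjective_of_separating continuous_etaLGL fun _ _ h x hx => h x hx⟩
  by_contra hxy
  -- A compact Hausdorff totally disconnected space is totally separated, so distinct points are
  -- told apart by a clopen set.
  obtain ⟨U, hU, hx, hy⟩ := exists_isClopen_of_totally_separated hxy
  have hle : etaLGL x ≤ etaLGL y := h.le
  exact hy (@hle ⟨U, hU⟩ hx)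

/-- As in the ordered case, reflection is the separation axiom for `∘`. -/
theorem etaLGL_mem_comp_iff {x y z : X} :
    etaLGL x ∈ comp (etaLGL y) (etaLGL z) ↔ x ∈ comp y z := by
  refine ⟨fun h => ?_, fun h U hy V hz => ⟨y, hy, z, hz, h⟩⟩
  by_contra hx
  obtain ⟨U, V, hU, hV, hy, hz, hx'⟩ := LGLSpace.exists_separating x y z hx
  exact hx' (h ⟨U, hU⟩ hy ⟨V, hV⟩ hz)

variable (X) in
/-- The homeomorphism of a Stone space with the prime filters of its clopen sets. -/
noncomputable def etaLGLHomeomorph : X ≃ₜ PrimeFilter (Clopens X) :=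
  Continuous.homeoOfEquivCompactToT2 (f := Equiv.ofBijective etaLGL etaLGL_bijective)
    continuous_etaLGL

end LGL

end PrimeFilter

/-! ### The natural isomorphisms -/

/-- The representation of ILGL algebras as a natural isomorphism. -/
noncomputable def unitILGL : 𝟭 ILGLAlg.{u} ≅ prILGL ⋙ clopILGL :=
  NatIso.ofComponents
    (fun A => ILGLAlg.isoOfBijective (B := (prILGL ⋙ clopILGL).obj A)
      (PrimeFilter.thetaILGL A.carrier) (PrimeFilter.thetaILGL_bijective _))
    -- Along a homomorphism `f`, both sides of the naturality square send `a` to the set of prime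
    -- filters containing `f a`.
    (fun _ => LayeredHom.ext_toFun fun _ => rfl)

/-- The representation of LGL algebras as a natural isomorphism. -/
noncomputable def unitLGL : 𝟭 LGLAlg.{u} ≅ prLGL ⋙ clopLGL :=
  NatIso.ofComponents
    (fun A => LGLAlg.isoOfBijective (B := (prLGL ⋙ clopLGL).obj A)
      (PrimeFilter.thetaLGL A.carrier) (PrimeFilter.thetaLGL_bijective _))
    (fun _ => LayeredHom.ext_toFun fun _ => rfl)

/-- The representation of ILGL spaces as a natural isomorphism. -/
noncomputable def counitILGL : clopILGL ⋙ prILGL ≅ 𝟭 ILGLSp.{u}ᵒᵖ :=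
  NatIso.ofComponents
    -- Passing to the opposite category reverses the isomorphism from `X` to its double dual, so it
    -- appears as a counit.
    (fun X => (ILGLSp.isoOfHomeomorph (X := X.unop) (Y := (prILGL.obj (clopILGL.obj X)).unop)
      (PrimeFilter.etaILGLHomeomorph X.unop.carrier)
      (fun _ _ => PrimeFilter.etaILGL_le_iff)
      (fun _ _ _ => PrimeFilter.etaILGL_mem_comp_iff)).op)
    -- Along a map `g` of spaces, both sides send `x` to the filter of clopen upper sets containing
    -- `g x`.
    (fun _ => Quiver.Hom.unop_inj (ILGLMap.ext_toFun fun _ => rfl))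

/-- The representation of LGL spaces as a natural isomorphism. -/
noncomputable def counitLGL : clopLGL ⋙ prLGL ≅ 𝟭 LGLSp.{u}ᵒᵖ :=
  NatIso.ofComponents
    (fun X => (LGLSp.isoOfHomeomorph (X := X.unop) (Y := (prLGL.obj (clopLGL.obj X)).unop)
      (PrimeFilter.etaLGLHomeomorph X.unop.carrier)
      (fun _ _ _ => PrimeFilter.etaLGL_mem_comp_iff)).op)
    (fun _ => Quiver.Hom.unop_inj (LGLMap.ext_toFun fun _ => rfl))

end LayeredLogic

/-! ### The dual equivalences -/

open LayeredLogic in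
-- Bundling `θ`, `η` and the triangle identity into an equivalence with the opposite category
-- expresses the duality; the set equations then pin the unit and the counit to the prescribed maps,
-- so the claim is more than the existence of some equivalence.
theorem mainTheorem2 :
    (∃ (θ : 𝟭 ILGLAlg.{u} ≅ prILGL ⋙ clopILGL) (η : clopILGL ⋙ prILGL ≅ 𝟭 ILGLSp.{u}ᵒᵖ)
        (triangle : ∀ A : ILGLAlg.{u}, prILGL.map (θ.hom.app A) ≫ η.hom.app (prILGL.obj A) =
          𝟙 (prILGL.obj A)),
      let e : ILGLAlg.{u} ≌ ILGLSp.{u}ᵒᵖ := ⟨prILGL, clopILGL, θ, η, triangle⟩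
      (∀ (A : ILGLAlg.{u}) (a : A.carrier),
        SetLike.coe (A := ClopenUpperSet (PrimeFilter A.carrier)) ((e.unit.app A).toFun a) =
          {F | a ∈ F}) ∧
      (∀ (X : ILGLSp.{u}) (x : X.carrier),
        SetLike.coe (A := PrimeFilter (ClopenUpperSet X.carrier))
            ((e.counit.app (op X)).unop.toFun x) =
          {U | x ∈ U})) ∧
    (∃ (θ : 𝟭 LGLAlg.{u} ≅ prLGL ⋙ clopLGL) (η : clopLGL ⋙ prLGL ≅ 𝟭 LGLSp.{u}ᵒᵖ)
        (triangle : ∀ A : LGLAlg.{u}, prLGL.map (θ.hom.app A) ≫ η.hom.app (prLGL.obj A) =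
          𝟙 (prLGL.obj A)),
      let e : LGLAlg.{u} ≌ LGLSp.{u}ᵒᵖ := ⟨prLGL, clopLGL, θ, η, triangle⟩
      (∀ (A : LGLAlg.{u}) (a : A.carrier),
        SetLike.coe (A := Clopens (PrimeFilter A.carrier)) ((e.unit.app A).toFun a) =
          {F | a ∈ F}) ∧
      (∀ (X : LGLSp.{u}) (x : X.carrier),
        SetLike.coe (A := PrimeFilter (Clopens X.carrier))
            ((e.counit.app (op X)).unop.toFun x) =
          {U | x ∈ U})) := by

  exact ⟨⟨unitILGL, counitILGL,
      -- The composite sends a prime filter `F` to the set of all `a` with `F ∈ theta a`, which is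
      -- `F` again.
      fun _ => Quiver.Hom.unop_inj (ILGLMap.ext_toFun fun _ => rfl),
      fun _ _ => rfl, fun _ _ => rfl⟩,
    ⟨unitLGL, counitLGL,
      fun _ => Quiver.Hom.unop_inj (LGLMap.ext_toFun fun _ => rfl),
      fun _ _ => rfl, fun _ _ => rfl⟩⟩
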